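/- For $\tau$ in the upper half-plane put $q=e^{2\pi i\tau}$ and let a prime denote $q\frac{d}{dq}=\frac1{2\pi i}\frac{d}{d\tau}$. Define $$\mathcal P=1-8\sum_{n\ge1}\frac{(-1)^n n q^n}{1-q^n},\quad \tilde{\mathcal P}=1+24\sum_{n\ge1}\frac{nq^n}{1+q^n},\quad \mathcal Q=1+16\sum_{n\ge1}\frac{(-1)^n n^3q^n}{1-q^n},\quad \mathcal D=\tfrac1{64}(\tilde{\mathcal P}^2-\mathcal Q),\quad \tilde{\mathcal D}=\mathcal D\mathcal Q .$$ For a holomorphic function $f$ and a weight $k$ put $$B_k=kff''-(k+1)f'^2,\qquad A_k=k^2f^2f'''-3k(k+2)ff'f''+2(k+1)(k+2)f'^3,$$ $$C_k=k(k+1)ff''''-4(k+1)(k+3)f'f'''+3(k+2)(k+3)f''^2,$$ $$I_k=\frac{B_k}{f^{2+4/k}},\qquad J_k=\frac{A_k}{f^{3+6/k}},\qquad P_k=\frac{A_k^2}{B_k^3},\qquad Q_k=\frac{f^2C_k}{B_k^2},$$ where the powers of $f$ are formed with one and the same (arbitrary) value of $\log f$. Then the following hold. (0) $\mathcal P$ is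 holomorphic on the upper half-plane, and $$\mathcal P'=\tfrac14(\mathcal P^2-\mathcal Q),\qquad \tilde{\mathcal P}'=\tfrac12(\mathcal P\tilde{\mathcal P}-\mathcal Q),\qquad \mathcal Q'=(\mathcal P-\tilde{\mathcal P})\mathcal Q .$$ Moreover $\tilde{\mathcal P}$, $\mathcal Q$, $\mathcal D$ are modular forms on $\Gamma_0(2)$ of weights $2,4,4$, and $\tilde{\mathcal D}$ is a cusp form of weight $8$ on $\Gamma_0(2)$. (1) $f=\tilde{\mathcal P}$ satisfies $$3f^2f'''^2-36(ff'f''-f'^3)f'''+32ff''^3-3(12f'^2+f^4)f''^2+9f^3f'^2f''-\tfrac{27}4f^2f'^4=0,$$ and, wherever $f\ne0$, $\;3J_2^2+64I_2^3-12I_2^2=0$. (2) $f=\mathcal Q$ satisfies $$4f^4f'''^2-6f^2f'(6ff''-5f'^2)f'''+16f^3f''^3+f^2(21f'^2-4f^3)f''^2-10ff'^2(6f'^2-f^3)f''+25f'^6-\tfrac{25}4f^3f'^4=0,$$ and, wherever $f\ne0$, $\;J_4^2+16I_4^3-16I_4^2=0$. (3) $f=\mathcal D$ satisfies $$4f^4f'''^2-6f^2f'(6ff''-5f'^2)f'''+16f^3f''^3-f^2(256f^3-21f'^2)f''^2+20ff'^2(32f^3-3f'^2)f''+25f'^6-400f^3f'^4=0,$$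 and, wherever $f\ne0$, $\;J_4^2+16I_4^3-1024I_4^2=0$. (4) $f=\tilde{\mathcal D}$ satisfies $$16f^4f'''^2-30f^2f'(4ff''-3f'^2)f'''+32f^3f''^3+117f^2f'^2f''^2-8f(16f^5+27f'^4)f''+81f'^6+144f^5f'^2=0,$$ and, wherever $f\ne0$, $\;J_8^2+16I_8^3-4096I_8=0$. (5) The following fourth-order equations hold wherever $B_k\neq0$ and, after multiplication by $B_k^3$, on the whole upper half-plane: $128Q_8-9P_8-912=0$ for $\tilde{\mathcal D}$; $4Q_2-3P_2-64=0$ for $\tilde{\mathcal P}$; and $16Q_4-5P_4-176=0$ for both $\mathcal Q$ and $\mathcal D$. -/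

import Mathlib

open scoped UpperHalfPlane MatrixGroups Manifold

noncomputable section

namespace GammaZeroTwo

/-- The nome `q = exp (2 π i τ)`. -/
def nome (τ : ℍ) : ℂ := Complex.exp (2 * Real.pi * Complex.I * (τ : ℂ))

/-- The derivation `q d/dq = (2 π i)⁻¹ d/dτ` on functions on the upper half-plane
(denoted by a prime in the comments below). -/
abbrev dq (f : ℍ → ℂ) : ℍ → ℂ := Derivative.normalizedDerivOfComplex f

/-- `P = 1 - 8 ∑_{n ≥ 1} (-1)^n n q^n / (1 - q^n)`. -/
def P (τ : ℍ) : ℂ :=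
  1 - 8 * ∑' n : ℕ+, (-1 : ℂ) ^ (n : ℕ) * (n : ℂ) * nome τ ^ (n : ℕ) / (1 - nome τ ^ (n : ℕ))

/-- `P̃ = 1 + 24 ∑_{n ≥ 1} n q^n / (1 + q^n)`. -/
def Pt (τ : ℍ) : ℂ :=
  1 + 24 * ∑' n : ℕ+, (n : ℂ) * nome τ ^ (n : ℕ) / (1 + nome τ ^ (n : ℕ))

/-- `Q = 1 + 16 ∑_{n ≥ 1} (-1)^n n^3 q^n / (1 - q^n)`. -/
def Q (τ : ℍ) : ℂ :=
  1 + 16 * ∑' n : ℕ+,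
    (-1 : ℂ) ^ (n : ℕ) * (n : ℂ) ^ 3 * nome τ ^ (n : ℕ) / (1 - nome τ ^ (n : ℕ))

/-- `D = (P̃² - Q) / 64`. -/
def D (τ : ℍ) : ℂ := (Pt τ ^ 2 - Q τ) / 64

/-- `D̃ = D Q`. -/
def Dt (τ : ℍ) : ℂ := D τ * Q τ

/-- `k f f'' - (k+1) f'²`. -/
def covB (k : ℂ) (f : ℍ → ℂ) (τ : ℍ) : ℂ :=
  k * f τ * dq (dq f) τ - (k + 1) * dq f τ ^ 2

/-- `k² f² f''' - 3 k (k+2) f f' f'' + 2 (k+1) (k+2) f'³`. -/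
def covA (k : ℂ) (f : ℍ → ℂ) (τ : ℍ) : ℂ :=
  k ^ 2 * f τ ^ 2 * dq (dq (dq f)) τ - 3 * k * (k + 2) * f τ * dq f τ * dq (dq f) τ
    + 2 * (k + 1) * (k + 2) * dq f τ ^ 3

/-- `k (k+1) f f'''' - 4 (k+1) (k+3) f' f''' + 3 (k+2) (k+3) f''²`. -/
def covC (k : ℂ) (f : ℍ → ℂ) (τ : ℍ) : ℂ :=
  k * (k + 1) * f τ * dq (dq (dq (dq f))) τ - 4 * (k + 1) * (k + 3) * dq f τ * dq (dq (dq f)) τ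
    + 3 * (k + 2) * (k + 3) * dq (dq f) τ ^ 2

/-- The differential invariant `I_k = (k f f'' - (k+1) f'²) / f^(2+4/k)` at `τ`. The argument `l`
is a value of `log (f τ)`, fixing the branch of the power: `f^s = exp (s l)`. -/
def invI (k : ℂ) (f : ℍ → ℂ) (l : ℂ) (τ : ℍ) : ℂ :=
  covB k f τ / Complex.exp ((2 + 4 / k) * l)

/-- The differential invariant
`J_k = (k² f² f''' - 3 k (k+2) f f' f'' + 2 (k+1) (k+2) f'³) / f^(3+6/k)` at `τ`, with the same
convention on the power: `l` is a value of `log (f τ)`. -/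
def invJ (k : ℂ) (f : ℍ → ℂ) (l : ℂ) (τ : ℍ) : ℂ :=
  covA k f τ / Complex.exp ((3 + 6 / k) * l)

/-- The differential invariant `P_k`, meaningful where `k f f'' - (k+1) f'² ≠ 0`. -/
def invP (k : ℂ) (f : ℍ → ℂ) (τ : ℍ) : ℂ := covA k f τ ^ 2 / covB k f τ ^ 3

/-- The differential invariant `Q_k`, meaningful where `k f f'' - (k+1) f'² ≠ 0`. -/
def invQ (k : ℂ) (f : ℍ → ℂ) (τ : ℍ) : ℂ := f τ ^ 2 * covC k f τ / covB k f τ ^ 2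

/-- `f` satisfies the fourth-order equation `a Q_k + b P_k + c = 0`: in invariant form wherever
`P_k` and `Q_k` are defined, and, with denominators cleared, on the whole upper half-plane. -/
def SatisfiesLinearPQ (k a b c : ℂ) (f : ℍ → ℂ) : Prop :=
  (∀ τ : ℍ, covB k f τ ≠ 0 → a * invQ k f τ + b * invP k f τ + c = 0) ∧
  (∀ τ : ℍ, a * (f τ ^ 2 * covC k f τ * covB k f τ) + b * covA k f τ ^ 2
    + c * covB k f τ ^ 3 = 0)

end GammaZeroTwo

end

noncomputable section

namespace GammaZeroTwo

open UpperHalfPlane Filter Topology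
open scoped ModularForm

/-! The ring generated by `P`, `Pt` and `Q` is closed under `dq`, so each differential equation
becomes a polynomial identity in these functions, checked by `ring` once the derivatives are
substituted.

The closure rests on one vanishing theorem, `HasCuspValues.eq_zero`: a holomorphic `Γ₀(2)`-invariant
function of weight `k < 8` that tends to zero at both cusps is zero. Its cube divided by `Δ(τ)
Δ(2τ)` is a modular form of weight `3k - 24 < 0`. A linear relation of weight 4 or 6 is thus proved
by comparing two numbers, the limits at `∞` and at `0`.

Lambert series manipulations express `Pt`, `P`, `Q` through `E2` and `E₄` at `τ` and `2τ`, which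
gives modularity and the cusp values. The Serre derivative preserves modularity and multiplies cusp
values by `-k/12`, so the vanishing theorem yields `Pt'`, `Q'` and `E₄ = 4 Pt² - 3 Q`; together with
Ramanujan's formula `dq_E2`, proved by the same theorem, this yields `P'`.

In the covariants `covB` and `covA` the quasimodular `P` cancels; for instance `covB` equals `48
Dt`, `-64 D Q²`, `-D² Q`, `-Pt² Dt²` for `Pt`, `Q`, `D`, `Dt` respectively. -/

lemma norm_nome_lt_one (τ : ℍ) : ‖nome τ‖ < 1 := norm_exp_two_pi_I_lt_one τ

/-- Multiplication by a positive real number on the upper half-plane. -/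
def scale (r : ℝ) (hr : 0 < r) (τ : ℍ) : ℍ :=
  ⟨r * (τ : ℂ), by simpa using mul_pos hr τ.im_pos⟩

/-- The map `τ ↦ 2 τ`. -/
def dbl (τ : ℍ) : ℍ := scale 2 two_pos τ

/-- The map `τ ↦ τ / 2`. -/
def half (τ : ℍ) : ℍ := scale (1 / 2) one_half_pos τ

lemma coe_dbl (τ : ℍ) : (dbl τ : ℂ) = 2 * τ := by simp [dbl, scale]

lemma coe_half (τ : ℍ) : (half τ : ℂ) = τ / 2 := by
  simp [half, scale]; ring

lemma nome_dbl (τ : ℍ) : nome (dbl τ) = nome τ ^ 2 := by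
  rw [nome, nome, ← Complex.exp_nat_mul, coe_dbl]; push_cast; ring_nf

/-! ### Lambert series, and `P`, `Pt`, `Q` in terms of `E2` and `E₄` -/

/-- The Lambert series `∑ n ^ k r ^ n / (1 - r ^ n)`. -/
def lambert (k : ℕ) (r : ℂ) : ℂ :=
  ∑' n : ℕ+, (n : ℂ) ^ k * r ^ (n : ℕ) / (1 - r ^ (n : ℕ))

lemma summable_lambert (k : ℕ) {r : ℂ} (hr : ‖r‖ < 1) :
    Summable fun n : ℕ+ ↦ (n : ℂ) ^ k * r ^ (n : ℕ) / (1 - r ^ (n : ℕ)) :=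
  (summable_norm_pow_mul_geometric_div_one_sub k hr).comp_injective PNat.coe_injective

lemma one_sub_pow_pnat_ne_zero {r : ℂ} (hr : ‖r‖ < 1) (n : ℕ+) : 1 - r ^ (n : ℕ) ≠ 0 := by
  intro h
  have h1 : ‖r ^ (n : ℕ)‖ < 1 := by
    rw [norm_pow]; exact pow_lt_one₀ (norm_nonneg _) hr n.ne_zero
  rw [← sub_eq_zero.mp h] at h1
  simp at h1

lemma norm_sq_lt_one {r : ℂ} (hr : ‖r‖ < 1) : ‖r ^ 2‖ < 1 := by
  rw [norm_pow]; exact pow_lt_one₀ (norm_nonneg _) hr two_ne_zero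

/-- The sign `(-1)^n` is twice the indicator of the even numbers minus one, and the even terms `n =
2m` sum to `2^k` times the series at `r²`. -/
lemma tsum_neg_one_pow_lambert (k : ℕ) {r : ℂ} (hr : ‖r‖ < 1) :
    ∑' n : ℕ+, (-1 : ℂ) ^ (n : ℕ) * (n : ℂ) ^ k * r ^ (n : ℕ) / (1 - r ^ (n : ℕ))
      = 2 ^ (k + 1) * lambert k (r ^ 2) - lambert k r := by
  set a : ℕ+ → ℂ := fun n ↦ (n : ℂ) ^ k * r ^ (n : ℕ) / (1 - r ^ (n : ℕ)) with ha
  have hs : Summable a := summable_lambert k hr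
  have he : Function.Injective fun n : ℕ+ ↦ 2 * n := mul_right_injective 2
  have h2 : HasSum (a ∘ fun n : ℕ+ ↦ 2 * n) (2 ^ k * lambert k (r ^ 2)) := by
    refine HasSum.congr_fun ((summable_lambert k (norm_sq_lt_one hr)).hasSum.mul_left (2 ^ k))
      fun n ↦ ?_
    simp only [ha, Function.comp_apply, PNat.mul_coe, PNat.val_ofNat, Nat.cast_mul,
      Nat.cast_ofNat, pow_mul, mul_pow]
    ring
  have h4 : HasSum ((Set.range fun n : ℕ+ ↦ 2 * n).indicator a) (2 ^ k * lambert k (r ^ 2)) := by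
    rw [← hasSum_subtype_iff_indicator]
    exact he.hasSum_range_iff.mpr h2
  have h5 := ((h4.mul_left 2).sub hs.hasSum).tsum_eq
  rw [pow_succ, mul_comm (2 ^ k) 2, mul_assoc]
  refine Eq.trans (tsum_congr fun n ↦ ?_) h5
  by_cases hn : n ∈ Set.range fun n : ℕ+ ↦ 2 * n
  · rw [Set.indicator_of_mem hn]
    obtain ⟨m, rfl⟩ := hn
    have : (-1 : ℂ) ^ ((2 * m : ℕ+) : ℕ) = 1 := by simp [pow_mul]
    rw [this]
    ring
  · have hodd : Odd (n : ℕ) := by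
      rw [← Nat.not_even_iff_odd]
      rintro ⟨m, hm⟩
      refine hn ⟨⟨m, by have := n.pos; omega⟩, PNat.eq ?_⟩
      exact (two_mul m).trans hm.symm
    rw [Set.indicator_of_notMem hn, hodd.neg_one_pow]
    ring

/-- Termwise this is `x / (1 + x) = x / (1 - x) - 2 x² / (1 - x²)` with `x = r^n`. -/
lemma tsum_one_add_lambert {r : ℂ} (hr : ‖r‖ < 1) :
    ∑' n : ℕ+, (n : ℂ) * r ^ (n : ℕ) / (1 + r ^ (n : ℕ))
      = lambert 1 r - 2 * lambert 1 (r ^ 2) := by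
  have h := ((summable_lambert 1 hr).hasSum.sub
    ((summable_lambert 1 (norm_sq_lt_one hr)).hasSum.mul_left 2)).tsum_eq
  refine Eq.trans (tsum_congr fun n ↦ ?_) h
  have h1 := one_sub_pow_pnat_ne_zero hr n
  have h2 := one_sub_pow_pnat_ne_zero (norm_sq_lt_one hr) n
  have h3 : 1 - (r ^ 2) ^ (n : ℕ) = (1 - r ^ (n : ℕ)) * (1 + r ^ (n : ℕ)) := by
    rw [← pow_mul, mul_comm 2, pow_mul]; ring
  rw [h3] at h2 ⊢
  have h4 := right_ne_zero_of_mul h2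
  have h5 : (r ^ 2) ^ (n : ℕ) = (r ^ (n : ℕ)) ^ 2 := by rw [← pow_mul, mul_comm 2, pow_mul]
  rw [h5]
  field_simp
  ring

lemma E2_eq_lambert (τ : ℍ) : EisensteinSeries.E2 τ = 1 - 24 * lambert 1 (nome τ) := by
  rw [EisensteinSeries.E2_eq_tsum_cexp, lambert,
    tsum_pow_div_one_sub_eq_tsum_sigma (norm_nome_lt_one τ) 1]
  rfl

lemma E₄_eq_lambert (τ : ℍ) : ModularForm.E₄ τ = 1 + 240 * lambert 3 (nome τ) := by
  rw [lambert, tsum_pow_div_one_sub_eq_tsum_sigma (norm_nome_lt_one τ) 3]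
  have := EisensteinSeries.q_expansion_bernoulli (k := 4) (by norm_num) ⟨2, rfl⟩ τ
  rw [ModularForm.E₄, this, show bernoulli 4 = -1 / 30 by decide +kernel]
  simp only [zpow_natCast, nome]
  norm_num

lemma Pt_eq (τ : ℍ) :
    Pt τ = 2 * EisensteinSeries.E2 (dbl τ) - EisensteinSeries.E2 τ := by
  rw [Pt, tsum_one_add_lambert (norm_nome_lt_one τ), E2_eq_lambert, E2_eq_lambert, nome_dbl]
  ring

lemma P_eq (τ : ℍ) : P τ = (EisensteinSeries.E2 τ + 2 * Pt τ) / 3 := by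
  have h := tsum_neg_one_pow_lambert 1 (norm_nome_lt_one τ)
  simp only [pow_one] at h
  rw [P, h, Pt_eq, E2_eq_lambert, E2_eq_lambert, nome_dbl]
  ring

lemma Q_eq (τ : ℍ) :
    Q τ = (16 * ModularForm.E₄ (dbl τ) - ModularForm.E₄ τ) / 15 := by
  rw [Q, tsum_neg_one_pow_lambert 3 (norm_nome_lt_one τ), E₄_eq_lambert, E₄_eq_lambert, nome_dbl]
  ring

/-! ### Limits at `i∞` -/

lemma tendsto_qExpansion_coeff_zero {f : ℍ → ℂ}
    (hper : Function.Periodic (f ∘ ofComplex) (1 : ℝ)) (hf : MDiff f)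
    (hb : IsBoundedAtImInfty f) : Tendsto f atImInfty (𝓝 ((qExpansion 1 f).coeff 0)) := by
  have han := analyticAt_cuspFunction_zero one_pos hper hf hb
  rw [qExpansion_coeff_zero one_pos han hper, ← cuspFunction_apply_zero one_pos han hper]
  exact (han.continuousAt.tendsto.comp (qParam_tendsto_atImInfty one_pos)).congr
    fun τ ↦ eq_cuspFunction τ one_ne_zero hper

lemma tendsto_E₄ : Tendsto ModularForm.E₄ atImInfty (𝓝 1) := by
  have := tendsto_qExpansion_coeff_zero (f := ModularForm.E₄)
    (SlashInvariantFormClass.periodic_comp_ofComplex _ one_mem_strictPeriods_SL)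
    (ModularFormClass.holo _) (ModularFormClass.bdd_at_infty _)
  rwa [EisensteinSeries.E_qExpansion_coeff_zero _ ⟨2, rfl⟩] at this

/-- A function invariant under translation by `h` is periodic. -/
lemma periodic_comp_ofComplex_of_vadd {f : ℍ → ℂ} {h : ℝ} (hf : ∀ τ : ℍ, f (h +ᵥ τ) = f τ) :
    Function.Periodic (f ∘ ofComplex) h := by
  intro w
  by_cases! hw : 0 < w.im
  · have : 0 < (w + h).im := by simpa using hw
    simp only [Function.comp_apply, ofComplex_apply_of_im_pos this, ofComplex_apply_of_im_pos hw]
    rw [← hf ⟨w, hw⟩]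
    congr 1
    ext
    simp [add_comm]
  · have : (w + h).im ≤ 0 := by simpa using hw
    simp [ofComplex_apply_of_im_nonpos this, ofComplex_apply_of_im_nonpos hw]

lemma E2_vadd_one (τ : ℍ) : EisensteinSeries.E2 ((1 : ℝ) +ᵥ τ) = EisensteinSeries.E2 τ := by
  have : nome ((1 : ℝ) +ᵥ τ) = nome τ := by
    rw [nome, nome, coe_vadd, mul_add, Complex.exp_add]
    simp [Complex.exp_two_pi_mul_I]
  rw [E2_eq_lambert, E2_eq_lambert, this]

lemma periodic_E2 : Function.Periodic (EisensteinSeries.E2 ∘ ofComplex) (1 : ℝ) :=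
  periodic_comp_ofComplex_of_vadd E2_vadd_one

lemma analyticAt_cuspFunction_E2 : AnalyticAt ℂ (cuspFunction 1 EisensteinSeries.E2) 0 :=
  analyticAt_cuspFunction_zero one_pos periodic_E2 E2_mdifferentiable
    EisensteinSeries.isBoundedAtImInfty_E2

lemma hasSum_E2_qParam (τ : ℍ) : HasSum (fun m : ℕ ↦ (if m = 0 then 1 else
    -24 * ArithmeticFunction.sigma 1 m : ℂ) • Function.Periodic.qParam 1 τ ^ m)
      (EisensteinSeries.E2 τ) := by
  simp only [Function.Periodic.qParam, Complex.ofReal_one, div_one]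
  exact EisensteinSeries.hasSum_qExpansion_E2 (z := τ)

/-- `E2` is not a modular form, so its constant term is read off from the uniqueness of the power
series of the cusp function. -/
lemma tendsto_E2 : Tendsto EisensteinSeries.E2 atImInfty (𝓝 1) := by
  have h := tendsto_qExpansion_coeff_zero periodic_E2 E2_mdifferentiable
    EisensteinSeries.isBoundedAtImInfty_E2
  have hc := (hasFPowerSeriesOnBall_cuspFunction one_pos analyticAt_cuspFunction_E2
    hasSum_E2_qParam).coeff_zero ![]
  rw [qExpansion_coeff_zero one_pos analyticAt_cuspFunction_E2 periodic_E2,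
    ← cuspFunction_apply_zero one_pos analyticAt_cuspFunction_E2 periodic_E2, ← hc] at h
  simpa [FormalMultilinearSeries.ofScalars] using h

lemma scale_im {r : ℝ} (hr : 0 < r) (τ : ℍ) : (scale r hr τ).im = r * τ.im := by
  simp [scale, ← coe_im]

lemma tendsto_scale {r : ℝ} (hr : 0 < r) : Tendsto (scale r hr) atImInfty atImInfty := by
  refine tendsto_comap_iff.mpr ?_
  rw [show im ∘ scale r hr = fun τ : ℍ ↦ r * τ.im from funext (scale_im hr)]
  exact tendsto_comap.const_mul_atTop hr

lemma mdifferentiable_comp_scale {f : ℍ → ℂ} (hf : MDiff f) {r : ℝ} (hr : 0 < r) :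
    MDiff fun τ ↦ f (scale r hr τ) := by
  rw [UpperHalfPlane.mdifferentiable_iff] at hf ⊢
  have hm : Set.MapsTo (fun z : ℂ ↦ r * z) upperHalfPlaneSet upperHalfPlaneSet := fun z hz ↦ by
    simpa using mul_pos hr hz
  refine (hf.comp (by fun_prop) hm).congr fun z hz ↦ ?_
  simp only [Function.comp_apply]
  congr 1
  ext
  rw [ofComplex_apply_of_im_pos hz, ofComplex_apply_of_im_pos (hm hz)]
  simp [scale]

/-- If `f` is holomorphic with a limit at `i∞`, then `q df/dq` tends to zero there. -/
lemma tendsto_dq_zero {f : ℍ → ℂ} (hf : MDiff f) {a : ℂ} (ha : Tendsto f atImInfty (𝓝 a)) :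
    Tendsto (dq f) atImInfty (𝓝 0) := by
  rw [UpperHalfPlane.mdifferentiable_iff] at hf
  have hd : Tendsto (fun τ : ℍ ↦ deriv (f ∘ ofComplex) τ) atImInfty (𝓝 0) := by
    rw [Metric.tendsto_nhds]
    intro ε hε
    obtain ⟨A, hA⟩ := (atImInfty_mem _).mp (Metric.tendsto_nhds.mp ha (ε / 2) (half_pos hε))
    -- The margin `2` keeps the closed unit disc around `τ` inside the upper half-plane and above
    -- height `A`.
    refine (atImInfty_mem _).mpr ⟨max A 0 + 2, fun τ hτ ↦ ?_⟩
    have him : ∀ z ∈ Metric.closedBall (τ : ℂ) 1, max A 0 < z.im := fun z hz ↦ by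
      have h1 : |(z - τ).im| ≤ 1 :=
        (Complex.abs_im_le_norm _).trans (by simpa [dist_eq_norm] using hz)
      have h2 := (abs_le.mp h1).1
      rw [Complex.sub_im, coe_im] at h2
      linarith
    have hpos : ∀ z ∈ Metric.closedBall (τ : ℂ) 1, 0 < z.im := fun z hz ↦
      (le_max_right A 0).trans_lt (him z hz)
    have hdiff : DifferentiableOn ℂ (fun z ↦ (f ∘ ofComplex) z - a) (Metric.closedBall (τ : ℂ) 1) :=
      (hf.mono hpos).sub_const a
    -- Cauchy's estimate on the unit circle, applied to `f - a`, which is bounded there by `ε / 2`.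
    have hbd := Complex.norm_deriv_le_of_forall_mem_sphere_norm_le (C := ε / 2) one_pos
      (hdiff.diffContOnCl_ball subset_rfl) fun z hz ↦ by
        have hz' := Metric.sphere_subset_closedBall hz
        have := hA ⟨z, hpos z hz'⟩ (((le_max_left A 0).trans_lt (him z hz')).le)
        rw [Function.comp_apply, ofComplex_apply_of_im_pos (hpos z hz')]
        rw [← dist_eq_norm]
        exact le_of_lt this
    rw [deriv_sub_const, div_one] at hbd
    simpa using hbd.trans_lt (half_lt_self hε)
  have := hd.const_mul (2 * Real.pi * Complex.I)⁻¹
  rwa [mul_zero] at this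

/-! ### The map `τ ↦ 2τ` and the modular group -/

/-- If `γ ∈ Γ₀(2)`, then `2 (γ τ) = γ' (2 τ)` for some `γ' ∈ SL(2, ℤ)`. -/
lemma exists_smul_dbl {γ : SL(2, ℤ)} (hγ : γ ∈ CongruenceSubgroup.Gamma0 2) :
    ∃ γ' : SL(2, ℤ), 2 * γ' 1 0 = γ 1 0 ∧ ∀ τ : ℍ,
      dbl (γ • τ) = γ' • dbl τ ∧ denom γ' (dbl τ) = denom γ τ := by
  obtain ⟨c, hc⟩ := (ZMod.intCast_zmod_eq_zero_iff_dvd _ 2).mp (CongruenceSubgroup.Gamma0_mem.mp hγ)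
  push_cast at hc
  have hdet := Matrix.SpecialLinearGroup.det_coe γ
  rw [Matrix.det_fin_two, hc] at hdet
  obtain ⟨γ', h00, h01, h10, h11⟩ : ∃ γ' : SL(2, ℤ), γ' 0 0 = γ 0 0 ∧ γ' 0 1 = 2 * γ 0 1 ∧
      γ' 1 0 = c ∧ γ' 1 1 = γ 1 1 :=
    -- The conjugate of `γ` by `diag(2, 1)`, integral because the lower left entry of `γ` is even.
    ⟨⟨!![γ 0 0, 2 * γ 0 1; c, γ 1 1], by rw [Matrix.det_fin_two_of]; linarith⟩, by simp⟩
  have hden : ∀ τ : ℍ, denom γ' (dbl τ) = denom γ τ := fun τ ↦ by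
    rw [ModularGroup.denom_apply, ModularGroup.denom_apply, coe_dbl, hc, h10, h11]
    push_cast
    ring
  refine ⟨γ', by rw [h10, hc], fun τ ↦ ⟨?_, hden τ⟩⟩
  ext
  rw [coe_dbl, coe_specialLinearGroup_apply, coe_specialLinearGroup_apply, coe_dbl, hc, h00, h01,
    h10, h11, ← mul_div_assoc]
  simp only [algebraMap_int_eq, eq_intCast]
  push_cast
  congr 1 <;> ring

lemma dbl_S_smul (τ : ℍ) : dbl (ModularGroup.S • τ) = ModularGroup.S • half τ := by
  ext
  have := τ.ne_zero
  rw [coe_dbl, modular_S_smul, modular_S_smul]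
  simp only [coe_half]
  field_simp

lemma slash_S_apply (k : ℤ) (f : ℍ → ℂ) (τ : ℍ) :
    (f ∣[k] ModularGroup.S) τ = f (ModularGroup.S • τ) * (τ : ℂ) ^ (-k) := by
  rw [ModularForm.SL_slash_apply, ModularGroup.denom_S]

/-! ### Invariant functions with prescribed values at the two cusps -/

/-- A holomorphic function, invariant of weight `k` under `Γ₀(2)`, with value `a` at the cusp `∞`
and value `b` at the cusp `0`. -/
structure HasCuspValues (k : ℤ) (f : ℍ → ℂ) (a b : ℂ) : Prop where
  mdiff : MDiff f
  slash_eq : ∀ γ ∈ CongruenceSubgroup.Gamma0 2, f ∣[k] γ = f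
  tendsto_infty : Tendsto f atImInfty (𝓝 a)
  tendsto_zero : Tendsto (f ∣[k] ModularGroup.S) atImInfty (𝓝 b)

namespace HasCuspValues

variable {k l : ℤ} {f g : ℍ → ℂ} {a b c d : ℂ}

lemma add (hf : HasCuspValues k f a b) (hg : HasCuspValues k g c d) :
    HasCuspValues k (f + g) (a + c) (b + d) where
  mdiff := hf.mdiff.add hg.mdiff
  slash_eq γ hγ := by rw [SlashAction.add_slash, hf.slash_eq γ hγ, hg.slash_eq γ hγ]
  tendsto_infty := hf.tendsto_infty.add hg.tendsto_infty
  tendsto_zero := by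
    rw [SlashAction.add_slash]; exact hf.tendsto_zero.add hg.tendsto_zero

lemma const_smul (hf : HasCuspValues k f a b) (r : ℂ) :
    HasCuspValues k (r • f) (r * a) (r * b) where
  mdiff := hf.mdiff.const_smul r
  slash_eq γ hγ := by rw [ModularForm.SL_smul_slash, hf.slash_eq γ hγ]
  tendsto_infty := hf.tendsto_infty.const_mul r
  tendsto_zero := by
    rw [ModularForm.SL_smul_slash]; exact hf.tendsto_zero.const_mul r

lemma mul (hf : HasCuspValues k f a b) (hg : HasCuspValues l g c d) :
    HasCuspValues (k + l) (f * g) (a * c) (b * d) where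
  mdiff := hf.mdiff.mul hg.mdiff
  slash_eq γ hγ := by rw [ModularForm.mul_slash_SL2, hf.slash_eq γ hγ, hg.slash_eq γ hγ]
  tendsto_infty := hf.tendsto_infty.mul hg.tendsto_infty
  tendsto_zero := by
    rw [ModularForm.mul_slash_SL2]; exact hf.tendsto_zero.mul hg.tendsto_zero

lemma mdiff_slash (hf : MDiff f) (k : ℤ) (γ : SL(2, ℤ)) : MDiff (f ∣[k] γ) :=
  hf.slash k _

/-- The Serre derivative commutes with the slash action, so both cusps reduce to one limit: `dq h`
tends to zero and `E2` to one, leaving `-k/12` times the limit of `h`. -/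
lemma serreDerivative (hf : HasCuspValues k f a b) :
    HasCuspValues (k + 2) (Derivative.serreDerivative k f) (-(k / 12) * a) (-(k / 12) * b) := by
  have key : ∀ {h : ℍ → ℂ} {x : ℂ}, MDiff h → Tendsto h atImInfty (𝓝 x) →
      Tendsto (Derivative.serreDerivative k h) atImInfty (𝓝 (-(k / 12) * x)) := fun {h x} hm ht ↦ by
    have := (tendsto_dq_zero hm ht).sub
      (((tendsto_E2.const_mul ((k : ℂ) * 12⁻¹))).mul ht)
    rw [show -(k / 12 : ℂ) * x = 0 - k * 12⁻¹ * 1 * x by ring]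
    exact this
  refine ⟨Derivative.serreDerivative_mdifferentiable _ hf.mdiff, fun γ hγ ↦
    Derivative.serreDerivative_slash_invariant hf.mdiff (hf.slash_eq γ hγ),
    key hf.mdiff hf.tendsto_infty, ?_⟩
  rw [Derivative.serreDerivative_slash_equivariant hf.mdiff]
  exact key (mdiff_slash hf.mdiff _ _) hf.tendsto_zero

lemma of_levelOne (hf : MDiff f) (hs : ∀ γ : SL(2, ℤ), f ∣[k] γ = f)
    (ha : Tendsto f atImInfty (𝓝 a)) : HasCuspValues k f a a :=
  ⟨hf, fun γ _ ↦ hs γ, ha, by rwa [hs]⟩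

lemma slash_S_comp_dbl (hs : ∀ γ : SL(2, ℤ), f ∣[k] γ = f) :
    (fun τ ↦ f (dbl τ)) ∣[k] ModularGroup.S = fun τ ↦ 2 ^ (-k) * f (half τ) := by
  ext τ
  rw [slash_S_apply, dbl_S_smul]
  have := slash_S_apply k f (half τ)
  rw [hs, coe_half, div_zpow] at this
  have h2 : ((2 : ℂ) ^ (-k)) ≠ 0 := zpow_ne_zero _ two_ne_zero
  rw [this]
  field_simp

lemma comp_dbl (hf : MDiff f) (hs : ∀ γ : SL(2, ℤ), f ∣[k] γ = f)
    (ha : Tendsto f atImInfty (𝓝 a)) :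
    HasCuspValues k (fun τ ↦ f (dbl τ)) a (2 ^ (-k) * a) := by
  refine ⟨mdifferentiable_comp_scale hf two_pos, fun γ hγ ↦ ?_, ha.comp (tendsto_scale two_pos), ?_⟩
  · obtain ⟨γ', -, h⟩ := exists_smul_dbl hγ
    ext τ
    rw [ModularForm.SL_slash_apply, (h τ).1, ← (h τ).2, ← ModularForm.SL_slash_apply, hs]
  · rw [slash_S_comp_dbl hs]
    exact (ha.comp (tendsto_scale one_half_pos)).const_mul (2 ^ (-k))

end HasCuspValues

/-! ### Cosets of `Γ₀(2)` and behaviour at all cusps -/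

lemma mem_Gamma0_two_iff {γ : SL(2, ℤ)} : γ ∈ CongruenceSubgroup.Gamma0 2 ↔ Even (γ 1 0) := by
  rw [CongruenceSubgroup.Gamma0_mem, ZMod.intCast_zmod_eq_zero_iff_dvd, even_iff_two_dvd]
  rfl

lemma coe_S_inv : ((ModularGroup.S⁻¹ : SL(2, ℤ)) : Matrix (Fin 2) (Fin 2) ℤ) = !![0, 1; -1, 0] := by
  rw [Matrix.SpecialLinearGroup.SL2_inv_expl, ModularGroup.S]
  ext i j
  fin_cases i <;> fin_cases j <;> simp

/-- The right cosets of `Γ₀(2)` in `SL(2, ℤ)` are represented by `1`, `S` and `S T`. -/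
lemma mem_Gamma0_two_or (γ : SL(2, ℤ)) :
    γ ∈ CongruenceSubgroup.Gamma0 2 ∨ γ * ModularGroup.S⁻¹ ∈ CongruenceSubgroup.Gamma0 2 ∨
      γ * ModularGroup.T⁻¹ * ModularGroup.S⁻¹ ∈ CongruenceSubgroup.Gamma0 2 := by
  have h1 : (γ * ModularGroup.S⁻¹) 1 0 = -γ 1 1 := by
    rw [Matrix.SpecialLinearGroup.coe_mul, coe_S_inv]
    simp [Matrix.mul_apply]
  have h2 : (γ * ModularGroup.T⁻¹ * ModularGroup.S⁻¹) 1 0 = γ 1 0 - γ 1 1 := by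
    rw [Matrix.SpecialLinearGroup.coe_mul, Matrix.SpecialLinearGroup.coe_mul, coe_S_inv,
      ModularGroup.coe_T_inv]
    simp [Matrix.mul_apply]
    ring
  rw [mem_Gamma0_two_iff, mem_Gamma0_two_iff, mem_Gamma0_two_iff, h1, h2, even_neg, Int.even_sub]
  tauto

/-- A property of functions which is stable under `T` holds for all the translates of a
`Γ₀(2)`-invariant function as soon as it holds at the two cusps. -/
lemma forall_slash_of_cusps {k : ℤ} {f : ℍ → ℂ} {p : (ℍ → ℂ) → Prop}
    (hf : ∀ γ ∈ CongruenceSubgroup.Gamma0 2, f ∣[k] γ = f)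
    (hT : ∀ g, p g → p (g ∣[k] ModularGroup.T)) (h₁ : p f) (h₂ : p (f ∣[k] ModularGroup.S))
    (γ : SL(2, ℤ)) : p (f ∣[k] γ) := by
  rcases mem_Gamma0_two_or γ with h | h | h
  · rwa [hf γ h]
  · have := hf _ h
    rw [SlashAction.slash_mul] at this
    rw [← this, ← SlashAction.slash_mul, ← SlashAction.slash_mul] at h₂
    simpa using h₂
  · have := hf _ h
    have h₃ := hT _ h₂
    rw [← this, ← SlashAction.slash_mul, ← SlashAction.slash_mul] at h₃
    simpa using h₃

/-- Every cusp is an `SL(2, ℤ)`-translate of `∞`, so boundedness of all `f ∣[k] γ` is needed; the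
coset representatives reduce this to `f` and `f ∣[k] S`. -/
lemma exists_modularForm {k : ℤ} {f : ℍ → ℂ} (hm : MDiff f)
    (hf : ∀ γ ∈ CongruenceSubgroup.Gamma0 2, f ∣[k] γ = f) (h₁ : IsBoundedAtImInfty f)
    (h₂ : IsBoundedAtImInfty (f ∣[k] ModularGroup.S)) :
    ∃ F : ModularForm ((CongruenceSubgroup.Gamma0 2).map (Matrix.SpecialLinearGroup.mapGL ℝ)) k,
      (F : ℍ → ℂ) = f := by
  refine ⟨⟨⟨f, ?_⟩, hm, fun {c} hc ↦ ?_⟩, rfl⟩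
  · rintro _ ⟨γ, hγ, rfl⟩
    exact hf γ hγ
  · rw [Subgroup.IsArithmetic.isCusp_iff_isCusp_SL2Z] at hc
    rw [OnePoint.isBoundedAt_iff_forall_SL2Z hc]
    refine fun γ _ ↦ forall_slash_of_cusps hf (fun g hg ↦ ?_) h₁ h₂ γ
    exact hg.slash k (by simp [Matrix.SpecialLinearGroup.mapGL_coe_matrix, ModularGroup.coe_T])

lemma exists_cuspForm {k : ℤ} {f : ℍ → ℂ} (hm : MDiff f)
    (hf : ∀ γ ∈ CongruenceSubgroup.Gamma0 2, f ∣[k] γ = f) (h₁ : IsZeroAtImInfty f)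
    (h₂ : IsZeroAtImInfty (f ∣[k] ModularGroup.S)) :
    ∃ F : CuspForm ((CongruenceSubgroup.Gamma0 2).map (Matrix.SpecialLinearGroup.mapGL ℝ)) k,
      (F : ℍ → ℂ) = f := by
  refine ⟨⟨⟨f, ?_⟩, hm, fun {c} hc ↦ ?_⟩, rfl⟩
  · rintro _ ⟨γ, hγ, rfl⟩
    exact hf γ hγ
  · rw [Subgroup.IsArithmetic.isCusp_iff_isCusp_SL2Z] at hc
    rw [OnePoint.isZeroAt_iff_forall_SL2Z hc]
    refine fun γ _ ↦ forall_slash_of_cusps hf (fun g hg ↦ ?_) h₁ h₂ γ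
    exact hg.slash k (by simp [Matrix.SpecialLinearGroup.mapGL_coe_matrix, ModularGroup.coe_T])

lemma HasCuspValues.exists_modularForm {k : ℤ} {f : ℍ → ℂ} {a b : ℂ}
    (hf : HasCuspValues k f a b) :
    ∃ F : ModularForm ((CongruenceSubgroup.Gamma0 2).map (Matrix.SpecialLinearGroup.mapGL ℝ)) k,
      (F : ℍ → ℂ) = f :=
  GammaZeroTwo.exists_modularForm hf.mdiff hf.slash_eq (hf.tendsto_infty.isBigO_one ℝ)
    (hf.tendsto_zero.isBigO_one ℝ)

/-! ### Vanishing of cusp forms of weight less than 8 -/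

lemma slash_T_zpow_apply (k n : ℤ) (f : ℍ → ℂ) (τ : ℍ) :
    (f ∣[k] (ModularGroup.T ^ n)) τ = f ((n : ℝ) +ᵥ τ) := by
  rw [ModularForm.SL_slash_apply, modular_T_zpow_smul, ModularGroup.denom_apply,
    ModularGroup.coe_T_zpow]
  simp

/-- This element expresses that the cusp `0` has width 2: it makes `f ∣[k] S` periodic with period
2, hence a function of `q^(1/2)`. -/
lemma S_mul_T_sq_mul_S_inv_mem :
    ModularGroup.S * ModularGroup.T ^ (2 : ℤ) * ModularGroup.S⁻¹ ∈ CongruenceSubgroup.Gamma0 2 := by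
  rw [mem_Gamma0_two_iff, Matrix.SpecialLinearGroup.coe_mul, Matrix.SpecialLinearGroup.coe_mul,
    ModularGroup.coe_T_zpow, coe_S_inv, ModularGroup.S]
  simp [Matrix.mul_apply, Fin.sum_univ_two]

namespace HasCuspValues

variable {k : ℤ} {f : ℍ → ℂ} {a b : ℂ}

lemma periodic (hf : HasCuspValues k f a b) : Function.Periodic (f ∘ ofComplex) (1 : ℝ) := by
  refine periodic_comp_ofComplex_of_vadd fun τ ↦ ?_
  have hT : ModularGroup.T ^ (1 : ℤ) ∈ CongruenceSubgroup.Gamma0 2 := by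
    rw [mem_Gamma0_two_iff, ModularGroup.coe_T_zpow]; simp
  have := congrFun (hf.slash_eq _ hT) τ
  rwa [slash_T_zpow_apply, Int.cast_one] at this

lemma periodic_slash_S (hf : HasCuspValues k f a b) :
    Function.Periodic ((f ∣[k] ModularGroup.S) ∘ ofComplex) (2 : ℝ) := by
  refine periodic_comp_ofComplex_of_vadd fun τ ↦ ?_
  have h := hf.slash_eq _ S_mul_T_sq_mul_S_inv_mem
  have h2 : (f ∣[k] ModularGroup.S) ∣[k] (ModularGroup.T ^ (2 : ℤ)) = f ∣[k] ModularGroup.S := by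
    conv_rhs => rw [← h]
    rw [← SlashAction.slash_mul, ← SlashAction.slash_mul]
    congr 1
    group
  have := congrFun h2 τ
  rwa [slash_T_zpow_apply, Int.cast_ofNat] at this

lemma isBigO_infty (hf : HasCuspValues k f 0 0) :
    f =O[atImInfty] fun τ ↦ Real.exp (-2 * Real.pi * τ.im) := by
  simpa using IsZeroAtImInfty.exp_decay_atImInfty hf.tendsto_infty one_pos hf.periodic hf.mdiff
    (hf.tendsto_infty.isBigO_one ℝ)

lemma isBigO_zero (hf : HasCuspValues k f 0 0) :
    (f ∣[k] ModularGroup.S) =O[atImInfty] fun τ ↦ Real.exp (-2 * Real.pi * τ.im / 2) :=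
  IsZeroAtImInfty.exp_decay_atImInfty hf.tendsto_zero two_pos hf.periodic_slash_S
    (mdiff_slash hf.mdiff _ _) (hf.tendsto_zero.isBigO_one ℝ)

lemma levelOne_discriminant : ∀ γ : SL(2, ℤ),
    ModularForm.discriminant ∣[(12 : ℤ)] γ = ModularForm.discriminant :=
  SlashInvariantForm.slash_action_generators_SL2Z ModularForm.discriminant_S_invariant
    ModularForm.discriminant_T_invariant

lemma discriminant : HasCuspValues 12 ModularForm.discriminant 0 0 :=
  of_levelOne CuspForm.discriminant.holo' levelOne_discriminant
    ModularForm.discriminant_isZeroAtImInfty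

lemma discriminant_dbl : HasCuspValues 12 (fun τ ↦ ModularForm.discriminant (dbl τ)) 0 0 := by
  simpa using comp_dbl (k := 12) CuspForm.discriminant.holo'
    levelOne_discriminant ModularForm.discriminant_isZeroAtImInfty

/-- There are no nonzero cusp forms of weight less than `8` on `Γ₀(2)`: the quotient of the cube of
such a form by `Δ(τ) Δ(2 τ)` would be a modular form of negative weight. -/
theorem eq_zero (hf : HasCuspValues k f 0 0) (hk : k < 8) : f = 0 := by
  set Δ := ModularForm.discriminant
  set Δ₂ : ℍ → ℂ := fun τ ↦ Δ (dbl τ)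
  have hΔ : ∀ τ, (Δ * Δ₂) τ ≠ 0 := fun τ ↦ mul_ne_zero
    (ModularForm.discriminant_ne_zero _) (ModularForm.discriminant_ne_zero _)
  have hnum := (hf.mul hf).mul hf
  have hden := discriminant.mul discriminant_dbl
  have hexp := ModularForm.exp_isBigO_discriminant
  -- At `∞` the cube is `O(q³)`, and `Δ(τ) Δ(2τ)` has exact order `q · q²`.
  have h₁ : (f * f * f) =O[atImInfty] (Δ * Δ₂) := by
    refine ((hf.isBigO_infty.mul hf.isBigO_infty).mul hf.isBigO_infty).trans
      (Asymptotics.IsBigO.trans (Asymptotics.isBigO_of_le _ fun τ ↦ ?_)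
        (hexp.mul (hexp.comp_tendsto (tendsto_scale two_pos))))
    rw [Function.comp_apply, ← Real.exp_add, ← Real.exp_add, ← Real.exp_add, dbl, scale_im]
    exact le_of_eq (by ring_nf)
  -- At `0` the cube is `O(q^(3/2))`, and the denominator becomes a constant times `Δ(τ) Δ(τ/2)`, of
  -- exact order `q · q^(1/2)`.
  have h₂ : ((f * f * f) ∣[k + k + k] ModularGroup.S) =O[atImInfty]
      ((Δ * Δ₂) ∣[(12 + 12 : ℤ)] ModularGroup.S) := by
    rw [ModularForm.mul_slash_SL2, ModularForm.mul_slash_SL2, ModularForm.mul_slash_SL2,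
      slash_S_comp_dbl levelOne_discriminant, levelOne_discriminant]
    refine ((hf.isBigO_zero.mul hf.isBigO_zero).mul hf.isBigO_zero).trans
      (Asymptotics.IsBigO.trans (Asymptotics.isBigO_of_le _ fun τ ↦ ?_)
        (hexp.mul ((hexp.comp_tendsto (tendsto_scale one_half_pos)).const_mul_right
          (zpow_ne_zero (-12) two_ne_zero))))
    rw [Function.comp_apply, ← Real.exp_add, ← Real.exp_add, ← Real.exp_add, scale_im]
    exact le_of_eq (by ring_nf)
  obtain ⟨F, hF⟩ := GammaZeroTwo.exists_modularForm (k := k + k + k - (12 + 12))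
    (f := (f * f * f) / (Δ * Δ₂)) (hnum.mdiff.div hden.mdiff hΔ)
    (fun γ hγ ↦ by rw [ModularForm.div_slash_SL2, hnum.slash_eq γ hγ, hden.slash_eq γ hγ])
    ((Asymptotics.div_isBoundedUnder_of_isBigO h₁).isBigO_one ℝ)
    (by
      rw [ModularForm.div_slash_SL2]
      exact (Asymptotics.div_isBoundedUnder_of_isBigO h₂).isBigO_one ℝ)
  have hF0 := F.isZero_of_neg_weight (by omega)
  ext τ
  have := congrFun hF τ
  rw [hF0] at this
  have h3 := (div_eq_zero_iff.mp this.symm).resolve_right (hΔ τ)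
  simpa using h3

end HasCuspValues

/-! ### Cusp values of `Pt`, `Q`, `D`, `Dt` -/

lemma E2_slash_apply (γ : SL(2, ℤ)) (τ : ℍ) :
    EisensteinSeries.E2 (γ • τ) * denom γ τ ^ (-2 : ℤ) = EisensteinSeries.E2 τ -
      1 / (2 * riemannZeta 2) * (2 * Real.pi * Complex.I * γ 1 0 / denom γ τ) := by
  rw [← ModularForm.SL_slash_apply, EisensteinSeries.E2_slash_action]
  rfl

/-- The two correction terms of `E2`, both multiples of `1/τ`, cancel: the one at `τ/2` is doubled,
and its coefficient is `2 · 1/4`. -/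
lemma Pt_slash_S_apply (τ : ℍ) :
    (Pt ∣[(2 : ℤ)] ModularGroup.S) τ =
      1 / 2 * EisensteinSeries.E2 (half τ) - EisensteinSeries.E2 τ := by
  have h1 := E2_slash_apply ModularGroup.S (half τ)
  have h2 := E2_slash_apply ModularGroup.S τ
  have hτ := τ.ne_zero
  rw [ModularGroup.denom_S, coe_half] at h1
  rw [ModularGroup.denom_S] at h2
  rw [slash_S_apply, Pt_eq, dbl_S_smul, sub_mul, h2]
  have h3 : (τ : ℂ) ^ (-2 : ℤ) = ((τ : ℂ) / 2) ^ (-2 : ℤ) / 4 := by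
    rw [div_zpow]; norm_num [zpow_neg]
    ring
  rw [h3, mul_div_assoc', mul_assoc 2, h1]
  field_simp
  ring

lemma hasCuspValues_Pt : HasCuspValues 2 Pt 1 (-1 / 2) := by
  have hPt : Pt = fun τ ↦ 2 * EisensteinSeries.E2 (dbl τ) - EisensteinSeries.E2 τ := funext Pt_eq
  refine ⟨?_, fun γ hγ ↦ ?_, ?_, ?_⟩
  · rw [hPt]
    exact ((mdifferentiable_comp_scale E2_mdifferentiable two_pos).const_smul (2 : ℂ)).sub
      E2_mdifferentiable
  · obtain ⟨γ', h10, h⟩ := exists_smul_dbl hγ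
    ext τ
    have h1 := E2_slash_apply γ' (dbl τ)
    have h2 := E2_slash_apply γ τ
    rw [(h τ).2] at h1
    -- The corrections of `2 E2(2τ)` and `E2(τ)` agree because `2 * γ' 1 0 = γ 1 0`.
    rw [ModularForm.SL_slash_apply, Pt_eq, Pt_eq, (h τ).1, sub_mul, mul_assoc, h1, h2, ← h10]
    push_cast
    ring
  · rw [hPt]
    have := ((tendsto_E2.comp (tendsto_scale two_pos)).const_mul 2).sub tendsto_E2
    rwa [show (2 : ℂ) * 1 - 1 = 1 by norm_num] at this
  · rw [funext Pt_slash_S_apply]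
    have := ((tendsto_E2.comp (tendsto_scale one_half_pos)).const_mul (1 / 2)).sub tendsto_E2
    rwa [show (1 / 2 : ℂ) * 1 - 1 = -1 / 2 by norm_num] at this

lemma levelOne_E₄ (γ : SL(2, ℤ)) : (ModularForm.E₄ : ℍ → ℂ) ∣[(4 : ℤ)] γ = ModularForm.E₄ :=
  ModularForm.E₄.slash_action_eq' _ ⟨γ, rfl⟩

lemma hasCuspValues_E₄ : HasCuspValues 4 ModularForm.E₄ 1 1 :=
  HasCuspValues.of_levelOne ModularForm.E₄.holo' levelOne_E₄ tendsto_E₄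

/-- The value at the cusp `0` is `16/15 · 2⁻⁴ - 1/15 = 0`. -/
lemma hasCuspValues_Q : HasCuspValues 4 Q 1 0 := by
  have h := ((HasCuspValues.comp_dbl (k := 4) (f := ModularForm.E₄) ModularForm.E₄.holo' levelOne_E₄
    tendsto_E₄).const_smul (16 / 15)).add (hasCuspValues_E₄.const_smul (-1 / 15))
  convert h using 1
  · ext τ
    rw [Q_eq]
    simp only [Pi.add_apply, Pi.smul_apply, smul_eq_mul]
    ring
  · norm_num
  · norm_num

lemma hasCuspValues_D : HasCuspValues 4 D 0 (1 / 256) := by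
  have h := ((hasCuspValues_Pt.mul hasCuspValues_Pt).const_smul (1 / 64)).add
    (hasCuspValues_Q.const_smul (-1 / 64))
  convert h using 1
  · norm_num
  · ext τ
    rw [D]
    simp only [Pi.add_apply, Pi.smul_apply, Pi.mul_apply, smul_eq_mul]
    ring
  · norm_num
  · norm_num

lemma hasCuspValues_Dt : HasCuspValues 8 Dt 0 0 := by
  have h := hasCuspValues_D.mul hasCuspValues_Q
  rwa [zero_mul, mul_zero] at h

/-! ### Ramanujan's formula for `E2` -/

lemma E2_slash_S : EisensteinSeries.E2 ∣[(2 : ℤ)] ModularGroup.S =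
    EisensteinSeries.E2 + (-(6 * Complex.I / Real.pi) : ℂ) • fun τ : ℍ ↦ (τ : ℂ)⁻¹ := by
  ext τ
  have hpi : (Real.pi : ℂ) ≠ 0 := by exact_mod_cast Real.pi_ne_zero
  rw [EisensteinSeries.E2_slash_action]
  simp only [Pi.sub_apply, Pi.add_apply, Pi.smul_apply, smul_eq_mul, EisensteinSeries.D2_S,
    riemannZeta_two]
  have := τ.ne_zero
  field_simp
  ring

lemma mdifferentiable_inv_coe : MDiff fun τ : ℍ ↦ (τ : ℂ)⁻¹ := by
  simpa [ModularGroup.denom_S] using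
    mdifferentiable_inv_denom (ModularGroup.S : GL (Fin 2) ℝ)

lemma dq_inv_coe (τ : ℍ) : dq (fun τ : ℍ ↦ (τ : ℂ)⁻¹) τ =
    -(2 * Real.pi * Complex.I)⁻¹ * ((τ : ℂ)⁻¹) ^ 2 := by
  have h : ((fun τ : ℍ ↦ (τ : ℂ)⁻¹) ∘ ofComplex) =ᶠ[𝓝 (τ : ℂ)] fun z ↦ z⁻¹ := by
    filter_upwards [isOpen_upperHalfPlaneSet.mem_nhds τ.im_pos] with z hz
    rw [Function.comp_apply, ofComplex_apply_of_im_pos hz]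
  rw [dq, Derivative.normalizedDerivOfComplex, h.deriv_eq, deriv_inv]
  rw [inv_pow]
  ring

/-- Obtained by differentiating the transformation law of `E2` under `S` and solving for the slashed
derivative. -/
lemma dq_E2_slash_S : dq EisensteinSeries.E2 ∣[(4 : ℤ)] ModularGroup.S =
    fun τ ↦ dq EisensteinSeries.E2 τ - Complex.I / Real.pi * (τ : ℂ)⁻¹ * EisensteinSeries.E2 τ
      - 3 / Real.pi ^ 2 * ((τ : ℂ)⁻¹) ^ 2 := by
  have h := Derivative.normalizedDerivOfComplex_SL_slash (k := 2) E2_mdifferentiable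
    (γ := ModularGroup.S)
  have hpi : (Real.pi : ℂ) ≠ 0 := by exact_mod_cast Real.pi_ne_zero
  ext τ
  have hτ := congrFun h τ
  rw [E2_slash_S, Derivative.normalizedDerivOfComplex_add _ _ E2_mdifferentiable
    (mdifferentiable_inv_coe.const_smul _)] at hτ
  rw [Derivative.normalizedDerivOfComplex_smul _ _ mdifferentiable_inv_coe] at hτ
  have hi := dq_inv_coe τ
  have h10 : ModularGroup.S 1 0 = 1 := rfl
  simp only [Pi.add_apply, Pi.sub_apply, Pi.smul_apply, smul_eq_mul, hi, ModularGroup.denom_S,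
    h10] at hτ
  push_cast at hτ
  have hI : (Complex.I)⁻¹ = -Complex.I := Complex.inv_I
  simp only [mul_inv, one_div, hI] at hτ
  linear_combination -hτ + 3 * (Real.pi : ℂ)⁻¹ ^ 2 * (τ : ℂ)⁻¹ ^ 2 * Complex.I_sq

/-- Ramanujan's formula for the derivative of `E₂`. -/
theorem dq_E2 (τ : ℍ) : dq EisensteinSeries.E2 τ =
    (EisensteinSeries.E2 τ ^ 2 - ModularForm.E₄ τ) / 12 := by
  set G : ℍ → ℂ := dq EisensteinSeries.E2 + ((-1 / 12 : ℂ) • (EisensteinSeries.E2 *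
    EisensteinSeries.E2) + (1 / 12 : ℂ) • (ModularForm.E₄ : ℍ → ℂ)) with hG
  have hslash : ∀ γ : SL(2, ℤ), G ∣[(4 : ℤ)] γ = dq EisensteinSeries.E2 ∣[(4 : ℤ)] γ +
      ((-1 / 12 : ℂ) • ((EisensteinSeries.E2 ∣[(2 : ℤ)] γ) * (EisensteinSeries.E2 ∣[(2 : ℤ)] γ)) +
      (1 / 12 : ℂ) • (ModularForm.E₄ : ℍ → ℂ)) := fun γ ↦ by
    rw [hG, SlashAction.add_slash, SlashAction.add_slash, ModularForm.SL_smul_slash,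
      ModularForm.SL_smul_slash, levelOne_E₄, ← ModularForm.mul_slash_SL2]
    rfl
  -- The terms in `1/τ` and `1/τ²` coming from `dq E2` are cancelled by those from `E2² / 12`.
  have hS : G ∣[(4 : ℤ)] ModularGroup.S = G := by
    rw [hslash, dq_E2_slash_S, E2_slash_S, hG]
    ext τ
    simp only [Pi.add_apply, Pi.smul_apply, Pi.mul_apply, smul_eq_mul]
    have hI := Complex.I_sq
    ring_nf
    rw [hI]
    ring
  have hT2 : EisensteinSeries.E2 ∣[(2 : ℤ)] ModularGroup.T = EisensteinSeries.E2 := by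
    rw [EisensteinSeries.E2_slash_action, EisensteinSeries.D2_T, smul_zero, sub_zero]
  have hT : G ∣[(4 : ℤ)] ModularGroup.T = G := by
    rw [hslash, hT2]
    have h := Derivative.normalizedDerivOfComplex_SL_slash (k := 2) E2_mdifferentiable
      (γ := ModularGroup.T)
    rw [hT2] at h
    rw [hG]
    congr 1
    refine Eq.trans ?_ h.symm
    ext τ
    simp [ModularGroup.T]
  have hv : HasCuspValues 4 G 0 0 := by
    refine HasCuspValues.of_levelOne ?_ (SlashInvariantForm.slash_action_generators_SL2Z hS hT) ?_
    · exact (Derivative.normalizedDerivOfComplex_mdifferentiable E2_mdifferentiable).add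
        (((E2_mdifferentiable.mul E2_mdifferentiable).const_smul _).add
          (ModularForm.E₄.holo'.const_smul _))
    · have := (tendsto_dq_zero E2_mdifferentiable tendsto_E2).add
        (((tendsto_E2.mul tendsto_E2).const_mul (-1 / 12)).add (tendsto_E₄.const_mul (1 / 12)))
      rwa [show (0 : ℂ) + (-1 / 12 * (1 * 1) + 1 / 12 * 1) = 0 by norm_num] at this
  have h0 := congrFun (hv.eq_zero (by norm_num)) τ
  simp only [hG, Pi.add_apply, Pi.smul_apply, Pi.mul_apply, smul_eq_mul,
    Pi.zero_apply] at h0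
  linear_combination h0

/-! ### Relations in weights 4 and 6 from cusp values -/

/-- The coefficients are forced by the cusps: `-1/6 - 1/3 + 1/2 = 0` at `∞` and `1/12 - 1/12 = 0` at
`0`. -/
lemma serreDerivative_Pt (τ : ℍ) :
    dq Pt τ - 2 / 12 * EisensteinSeries.E2 τ * Pt τ = Pt τ ^ 2 / 3 - Q τ / 2 := by
  have h := (hasCuspValues_Pt.serreDerivative.add
    (((hasCuspValues_Pt.mul hasCuspValues_Pt).const_smul (-1 / 3)))).add
      (hasCuspValues_Q.const_smul (1 / 2))
  norm_num at h
  have h0 := congrFun (h.eq_zero (by norm_num)) τ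
  simp only [Pi.add_apply, Pi.smul_apply, Pi.neg_apply, Pi.mul_apply, smul_eq_mul,
    Pi.zero_apply] at h0
  linear_combination h0

lemma serreDerivative_Q (τ : ℍ) :
    dq Q τ - 4 / 12 * EisensteinSeries.E2 τ * Q τ = -(Pt τ * Q τ) / 3 := by
  have h := hasCuspValues_Q.serreDerivative.add
    (((hasCuspValues_Pt.mul hasCuspValues_Q).const_smul (1 / 3)))
  norm_num at h
  have h0 := congrFun (h.eq_zero (by norm_num)) τ
  simp only [Pi.add_apply, Pi.smul_apply, Pi.mul_apply, smul_eq_mul,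
    Pi.zero_apply] at h0
  linear_combination h0

/-- The cusp values of the difference are `1 - 4 + 3 = 0` and `1 - 4 · 1/4 = 0`. -/
lemma E₄_eq (τ : ℍ) : ModularForm.E₄ τ = 4 * Pt τ ^ 2 - 3 * Q τ := by
  have h := (hasCuspValues_E₄.add
    (((hasCuspValues_Pt.mul hasCuspValues_Pt).const_smul (-4)))).add
      (hasCuspValues_Q.const_smul 3)
  norm_num at h
  have h0 := congrFun (h.eq_zero (by norm_num)) τ
  simp only [Pi.add_apply, Pi.smul_apply, Pi.neg_apply, Pi.mul_apply, smul_eq_mul,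
    Pi.zero_apply] at h0
  linear_combination h0

/-! ### Derivation calculus and the differential system -/

/-- `f` is holomorphic on the upper half-plane and `q df/dq = f'`. -/
def HasDq (f f' : ℍ → ℂ) : Prop := MDiff f ∧ ∀ τ, dq f τ = f' τ

namespace HasDq

variable {f g f' g' : ℍ → ℂ}

lemma eq (hf : HasDq f f') : dq f = f' := funext hf.2

lemma of_eq (hf : HasDq f f') (h : ∀ τ, f' τ = g' τ) : HasDq f g' :=
  ⟨hf.1, fun τ ↦ (hf.2 τ).trans (h τ)⟩

lemma const (c : ℂ) : HasDq (fun _ ↦ c) fun _ ↦ 0 :=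
  ⟨mdifferentiable_const, fun τ ↦ congrFun (Derivative.normalizedDerivOfComplex_const c) τ⟩

lemma add (hf : HasDq f f') (hg : HasDq g g') :
    HasDq (fun τ ↦ f τ + g τ) fun τ ↦ f' τ + g' τ :=
  ⟨hf.1.add hg.1, fun τ ↦ by
    simp only [← hf.2, ← hg.2]
    exact congrFun (Derivative.normalizedDerivOfComplex_add f g hf.1 hg.1) τ⟩

lemma sub (hf : HasDq f f') (hg : HasDq g g') :
    HasDq (fun τ ↦ f τ - g τ) fun τ ↦ f' τ - g' τ :=
  ⟨hf.1.sub hg.1, fun τ ↦ by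
    simp only [← hf.2, ← hg.2]
    exact congrFun (Derivative.normalizedDerivOfComplex_sub f g hf.1 hg.1) τ⟩

lemma mul (hf : HasDq f f') (hg : HasDq g g') :
    HasDq (fun τ ↦ f τ * g τ) fun τ ↦ f' τ * g τ + f τ * g' τ :=
  ⟨hf.1.mul hg.1, fun τ ↦ by
    simp only [← hf.2, ← hg.2]
    exact congrFun (Derivative.normalizedDerivOfComplex_mul f g hf.1 hg.1) τ⟩

lemma pow (hf : HasDq f f') (n : ℕ) :
    HasDq (fun τ ↦ f τ ^ n) fun τ ↦ n * f τ ^ (n - 1) * f' τ :=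
  ⟨hf.1.pow n, fun τ ↦ by
    simp only [← hf.2]
    exact congrFun (Derivative.normalizedDerivOfComplex_pow f n hf.1) τ⟩

end HasDq

/-- Substituting `E2 = 3 P - 2 Pt` in the Serre derivative makes the `Pt²` terms cancel. -/
lemma hasDq_Pt : HasDq Pt fun τ ↦ 1 / 2 * P τ * Pt τ - 1 / 2 * Q τ :=
  ⟨hasCuspValues_Pt.mdiff, fun τ ↦ by
    linear_combination serreDerivative_Pt τ - 1 / 2 * Pt τ * P_eq τ⟩

lemma hasDq_Q : HasDq Q fun τ ↦ Q τ * (P τ - Pt τ) :=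
  ⟨hasCuspValues_Q.mdiff, fun τ ↦ by
    linear_combination serreDerivative_Q τ - Q τ * P_eq τ⟩

lemma hasDq_P : HasDq P fun τ ↦ 1 / 4 * P τ ^ 2 - 1 / 4 * Q τ := by
  have h : HasDq EisensteinSeries.E2 (dq EisensteinSeries.E2) := ⟨E2_mdifferentiable, fun _ ↦ rfl⟩
  rw [show P = fun τ ↦ 1 / 3 * EisensteinSeries.E2 τ + 2 / 3 * Pt τ from
    funext fun τ ↦ by rw [P_eq]; ring]
  refine (((HasDq.const _).mul h).add ((HasDq.const _).mul hasDq_Pt)).of_eq fun τ ↦ ?_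
  rw [dq_E2, P_eq, E₄_eq]
  ring

lemma hasDq_D : HasDq D fun τ ↦ D τ * P τ := by
  rw [show D = fun τ ↦ 1 / 64 * Pt τ ^ 2 - 1 / 64 * Q τ from funext fun τ ↦ by rw [D]; ring]
  refine (((HasDq.const _).mul (hasDq_Pt.pow 2)).sub ((HasDq.const _).mul hasDq_Q)).of_eq
    fun τ ↦ ?_
  push_cast
  ring

lemma hasDq_Dt : HasDq Dt fun τ ↦ Dt τ * (2 * P τ - Pt τ) :=
  (hasDq_D.mul hasDq_Q).of_eq fun τ ↦ by rw [Dt]; ring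

lemma Q_eq_D (τ : ℍ) : Q τ = Pt τ ^ 2 - 64 * D τ := by rw [D]; ring

/-! ### Higher derivatives as polynomials -/

/-- The first four derivatives of `P̃` as polynomials in `P`, `P̃`, `Q`. -/
lemma dq_iterates_Pt (τ : ℍ) :
    dq Pt τ =
      1 / 2 * P τ * Pt τ - 1 / 2 * Q τ ∧
    dq (dq Pt) τ =
      3 / 8 * P τ ^ 2 * Pt τ - 3 / 4 * P τ * Q τ + 3 / 8 * Pt τ * Q τ ∧
    dq (dq (dq Pt)) τ =
      3 / 8 * P τ ^ 3 * Pt τ - 9 / 8 * P τ ^ 2 * Q τ + 9 / 8 * P τ * Pt τ * Q τ - 3 / 8 * Pt τ ^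
      2 * Q τ ∧
    dq (dq (dq (dq Pt))) τ =
      15 / 32 * P τ ^ 4 * Pt τ - 15 / 8 * P τ ^ 3 * Q τ + 45 / 16 * P τ ^ 2 * Pt τ * Q τ - 15 /
      8 * P τ * Pt τ ^ 2 * Q τ + 3 / 8 * Pt τ ^ 3 * Q τ + 3 / 32 * Pt τ * Q τ ^ 2 := by
  have h2 : HasDq (fun τ ↦
      1 / 2 * P τ * Pt τ - 1 / 2 * Q τ)
    fun τ ↦
      3 / 8 * P τ ^ 2 * Pt τ - 3 / 4 * P τ * Q τ + 3 / 8 * Pt τ * Q τ := by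
    refine HasDq.of_eq (by
      -- The derivative is assembled by following the syntax of the polynomial; `with_reducible`
      -- lets a rule fire only on the visible head operation.
      repeat' first
        | exact hasDq_P
        | exact hasDq_Pt
        | exact hasDq_Q
        | exact hasDq_D
        | exact hasDq_Dt
        | exact HasDq.const _
        | with_reducible apply HasDq.add
        | with_reducible apply HasDq.sub
        | with_reducible apply HasDq.mul) fun τ ↦ ?_
    ring
  have h3 : HasDq (fun τ ↦
      3 / 8 * P τ ^ 2 * Pt τ - 3 / 4 * P τ * Q τ + 3 / 8 * Pt τ * Q τ)
    fun τ ↦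
      3 / 8 * P τ ^ 3 * Pt τ - 9 / 8 * P τ ^ 2 * Q τ + 9 / 8 * P τ * Pt τ * Q τ - 3 / 8 * Pt τ ^
      2 * Q τ := by
    refine HasDq.of_eq (by
      repeat' first
        | exact hasDq_P
        | exact hasDq_Pt
        | exact hasDq_Q
        | exact hasDq_D
        | exact hasDq_Dt
        | exact HasDq.const _
        | with_reducible apply HasDq.add
        | with_reducible apply HasDq.sub
        | with_reducible apply HasDq.mul
        | with_reducible apply HasDq.pow) fun τ ↦ ?_
    push_cast
    ring
  have h4 : HasDq (fun τ ↦
      3 / 8 * P τ ^ 3 * Pt τ - 9 / 8 * P τ ^ 2 * Q τ + 9 / 8 * P τ * Pt τ * Q τ - 3 / 8 * Pt τ ^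
      2 * Q τ)
    fun τ ↦
      15 / 32 * P τ ^ 4 * Pt τ - 15 / 8 * P τ ^ 3 * Q τ + 45 / 16 * P τ ^ 2 * Pt τ * Q τ - 15 /
      8 * P τ * Pt τ ^ 2 * Q τ + 3 / 8 * Pt τ ^ 3 * Q τ + 3 / 32 * Pt τ * Q τ ^ 2 := by
    refine HasDq.of_eq (by
      repeat' first
        | exact hasDq_P
        | exact hasDq_Pt
        | exact hasDq_Q
        | exact hasDq_D
        | exact hasDq_Dt
        | exact HasDq.const _
        | with_reducible apply HasDq.add
        | with_reducible apply HasDq.sub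
        | with_reducible apply HasDq.mul
        | with_reducible apply HasDq.pow) fun τ ↦ ?_
    push_cast
    ring
  rw [hasDq_Pt.eq, h2.eq, h3.eq, h4.eq]
  exact ⟨rfl, rfl, rfl, rfl⟩

/-- The first four derivatives of `Q` in terms of `P`, `P̃`, `Q`. -/
lemma dq_iterates_Q (τ : ℍ) :
    dq Q τ =
      Q τ * (P τ - Pt τ) ∧
    dq (dq Q) τ =
      Q τ * (5 / 4 * P τ ^ 2 - 5 / 2 * P τ * Pt τ + Pt τ ^ 2 + 1 / 4 * Q τ) ∧
    dq (dq (dq Q)) τ =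
      Q τ * (15 / 8 * P τ ^ 3 - 45 / 8 * P τ ^ 2 * Pt τ + 9 / 2 * P τ * Pt τ ^ 2 + 9 / 8 * P τ *
      Q τ - Pt τ ^ 3 - 7 / 8 * Pt τ * Q τ) ∧
    dq (dq (dq (dq Q))) τ =
      Q τ * (105 / 32 * P τ ^ 4 - 105 / 8 * P τ ^ 3 * Pt τ + 63 / 4 * P τ ^ 2 * Pt τ ^ 2 + 63 /
      16 * P τ ^ 2 * Q τ - 7 * P τ * Pt τ ^ 3 - 49 / 8 * P τ * Pt τ * Q τ + Pt τ ^ 4 + 17 / 8 *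
      Pt τ ^ 2 * Q τ + 5 / 32 * Q τ ^ 2) := by
  have h2 : HasDq (fun τ ↦
      Q τ * (P τ - Pt τ))
    fun τ ↦
      Q τ * (5 / 4 * P τ ^ 2 - 5 / 2 * P τ * Pt τ + Pt τ ^ 2 + 1 / 4 * Q τ) := by
    refine HasDq.of_eq (by
      repeat' first
        | exact hasDq_P
        | exact hasDq_Pt
        | exact hasDq_Q
        | exact hasDq_D
        | exact hasDq_Dt
        | exact HasDq.const _
        | with_reducible apply HasDq.add
        | with_reducible apply HasDq.sub
        | with_reducible apply HasDq.mul) fun τ ↦ ?_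
    ring
  have h3 : HasDq (fun τ ↦
      Q τ * (5 / 4 * P τ ^ 2 - 5 / 2 * P τ * Pt τ + Pt τ ^ 2 + 1 / 4 * Q τ))
    fun τ ↦
      Q τ * (15 / 8 * P τ ^ 3 - 45 / 8 * P τ ^ 2 * Pt τ + 9 / 2 * P τ * Pt τ ^ 2 + 9 / 8 * P τ *
      Q τ - Pt τ ^ 3 - 7 / 8 * Pt τ * Q τ) := by
    refine HasDq.of_eq (by
      repeat' first
        | exact hasDq_P
        | exact hasDq_Pt
        | exact hasDq_Q
        | exact hasDq_D
        | exact hasDq_Dt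
        | exact HasDq.const _
        | with_reducible apply HasDq.add
        | with_reducible apply HasDq.sub
        | with_reducible apply HasDq.mul
        | with_reducible apply HasDq.pow) fun τ ↦ ?_
    push_cast
    ring
  have h4 : HasDq (fun τ ↦
      Q τ * (15 / 8 * P τ ^ 3 - 45 / 8 * P τ ^ 2 * Pt τ + 9 / 2 * P τ * Pt τ ^ 2 + 9 / 8 * P τ *
      Q τ - Pt τ ^ 3 - 7 / 8 * Pt τ * Q τ))
    fun τ ↦
      Q τ * (105 / 32 * P τ ^ 4 - 105 / 8 * P τ ^ 3 * Pt τ + 63 / 4 * P τ ^ 2 * Pt τ ^ 2 + 63 /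
      16 * P τ ^ 2 * Q τ - 7 * P τ * Pt τ ^ 3 - 49 / 8 * P τ * Pt τ * Q τ + Pt τ ^ 4 + 17 / 8 *
      Pt τ ^ 2 * Q τ + 5 / 32 * Q τ ^ 2) := by
    refine HasDq.of_eq (by
      repeat' first
        | exact hasDq_P
        | exact hasDq_Pt
        | exact hasDq_Q
        | exact hasDq_D
        | exact hasDq_Dt
        | exact HasDq.const _
        | with_reducible apply HasDq.add
        | with_reducible apply HasDq.sub
        | with_reducible apply HasDq.mul
        | with_reducible apply HasDq.pow) fun τ ↦ ?_
    push_cast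
    ring
  rw [hasDq_Q.eq, h2.eq, h3.eq, h4.eq]
  exact ⟨rfl, rfl, rfl, rfl⟩

/-- The first four derivatives of `D` in terms of `P`, `P̃`, `D`. -/
lemma dq_iterates_D (τ : ℍ) :
    dq D τ =
      D τ * (P τ) ∧
    dq (dq D) τ =
      D τ * (5 / 4 * P τ ^ 2 - 1 / 4 * Pt τ ^ 2 + 16 * D τ) ∧
    dq (dq (dq D)) τ =
      D τ * (15 / 8 * P τ ^ 3 - 9 / 8 * P τ * Pt τ ^ 2 + 72 * P τ * D τ + 1 / 4 * Pt τ ^ 3 - 16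
      * Pt τ * D τ) ∧
    dq (dq (dq (dq D))) τ =
      D τ * (105 / 32 * P τ ^ 4 - 63 / 16 * P τ ^ 2 * Pt τ ^ 2 + 252 * P τ ^ 2 * D τ + 7 / 4 * P
      τ * Pt τ ^ 3 - 112 * P τ * Pt τ * D τ - 3 / 32 * Pt τ ^ 4 - 4 * Pt τ ^ 2 * D τ + 640 * D τ
      ^ 2) := by
  have h2 : HasDq (fun τ ↦
      D τ * (P τ))
    fun τ ↦
      D τ * (5 / 4 * P τ ^ 2 - 1 / 4 * Pt τ ^ 2 + 16 * D τ) := by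
    refine HasDq.of_eq (by
      repeat' first
        | exact hasDq_P
        | exact hasDq_Pt
        | exact hasDq_Q
        | exact hasDq_D
        | exact hasDq_Dt
        | exact HasDq.const _
        | with_reducible apply HasDq.add
        | with_reducible apply HasDq.sub
        | with_reducible apply HasDq.mul) fun τ ↦ ?_
    -- Eliminating `Q` leaves `P`, `Pt`, `D`, in which the identity is purely polynomial.
    simp only [Q_eq_D]
    ring
  have h3 : HasDq (fun τ ↦
      D τ * (5 / 4 * P τ ^ 2 - 1 / 4 * Pt τ ^ 2 + 16 * D τ))
    fun τ ↦
      D τ * (15 / 8 * P τ ^ 3 - 9 / 8 * P τ * Pt τ ^ 2 + 72 * P τ * D τ + 1 / 4 * Pt τ ^ 3 - 16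
      * Pt τ * D τ) := by
    refine HasDq.of_eq (by
      repeat' first
        | exact hasDq_P
        | exact hasDq_Pt
        | exact hasDq_Q
        | exact hasDq_D
        | exact hasDq_Dt
        | exact HasDq.const _
        | with_reducible apply HasDq.add
        | with_reducible apply HasDq.sub
        | with_reducible apply HasDq.mul
        | with_reducible apply HasDq.pow) fun τ ↦ ?_
    push_cast [Q_eq_D]
    ring
  have h4 : HasDq (fun τ ↦
      D τ * (15 / 8 * P τ ^ 3 - 9 / 8 * P τ * Pt τ ^ 2 + 72 * P τ * D τ + 1 / 4 * Pt τ ^ 3 - 16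
      * Pt τ * D τ))
    fun τ ↦
      D τ * (105 / 32 * P τ ^ 4 - 63 / 16 * P τ ^ 2 * Pt τ ^ 2 + 252 * P τ ^ 2 * D τ + 7 / 4 * P
      τ * Pt τ ^ 3 - 112 * P τ * Pt τ * D τ - 3 / 32 * Pt τ ^ 4 - 4 * Pt τ ^ 2 * D τ + 640 * D τ
      ^ 2) := by
    refine HasDq.of_eq (by
      repeat' first
        | exact hasDq_P
        | exact hasDq_Pt
        | exact hasDq_Q
        | exact hasDq_D
        | exact hasDq_Dt
        | exact HasDq.const _
        | with_reducible apply HasDq.add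
        | with_reducible apply HasDq.sub
        | with_reducible apply HasDq.mul
        | with_reducible apply HasDq.pow) fun τ ↦ ?_
    push_cast [Q_eq_D]
    ring
  rw [hasDq_D.eq, h2.eq, h3.eq, h4.eq]
  exact ⟨rfl, rfl, rfl, rfl⟩

/-- The first four derivatives of `D̃` in terms of `P`, `P̃`, `Q`. -/
lemma dq_iterates_Dt (τ : ℍ) :
    dq Dt τ =
      Dt τ * (2 * P τ - Pt τ) ∧
    dq (dq Dt) τ =
      Dt τ * (9 / 2 * P τ ^ 2 - 9 / 2 * P τ * Pt τ + Pt τ ^ 2) ∧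
    dq (dq (dq Dt)) τ =
      Dt τ * (45 / 4 * P τ ^ 3 - 135 / 8 * P τ ^ 2 * Pt τ + 15 / 2 * P τ * Pt τ ^ 2 - Pt τ ^ 3 +
      1 / 8 * Pt τ * Q τ) ∧
    dq (dq (dq (dq Dt))) τ =
      Dt τ * (495 / 16 * P τ ^ 4 - 495 / 8 * P τ ^ 3 * Pt τ + 165 / 4 * P τ ^ 2 * Pt τ ^ 2 - 11
      * P τ * Pt τ ^ 3 + 11 / 8 * P τ * Pt τ * Q τ + Pt τ ^ 4 - 5 / 8 * Pt τ ^ 2 * Q τ - 1 / 16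
      * Q τ ^ 2) := by
  have h2 : HasDq (fun τ ↦
      Dt τ * (2 * P τ - Pt τ))
    fun τ ↦
      Dt τ * (9 / 2 * P τ ^ 2 - 9 / 2 * P τ * Pt τ + Pt τ ^ 2) := by
    refine HasDq.of_eq (by
      repeat' first
        | exact hasDq_P
        | exact hasDq_Pt
        | exact hasDq_Q
        | exact hasDq_D
        | exact hasDq_Dt
        | exact HasDq.const _
        | with_reducible apply HasDq.add
        | with_reducible apply HasDq.sub
        | with_reducible apply HasDq.mul) fun τ ↦ ?_
    ring
  have h3 : HasDq (fun τ ↦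
      Dt τ * (9 / 2 * P τ ^ 2 - 9 / 2 * P τ * Pt τ + Pt τ ^ 2))
    fun τ ↦
      Dt τ * (45 / 4 * P τ ^ 3 - 135 / 8 * P τ ^ 2 * Pt τ + 15 / 2 * P τ * Pt τ ^ 2 - Pt τ ^ 3 +
      1 / 8 * Pt τ * Q τ) := by
    refine HasDq.of_eq (by
      repeat' first
        | exact hasDq_P
        | exact hasDq_Pt
        | exact hasDq_Q
        | exact hasDq_D
        | exact hasDq_Dt
        | exact HasDq.const _
        | with_reducible apply HasDq.add
        | with_reducible apply HasDq.sub
        | with_reducible apply HasDq.mul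
        | with_reducible apply HasDq.pow) fun τ ↦ ?_
    push_cast
    ring
  have h4 : HasDq (fun τ ↦
      Dt τ * (45 / 4 * P τ ^ 3 - 135 / 8 * P τ ^ 2 * Pt τ + 15 / 2 * P τ * Pt τ ^ 2 - Pt τ ^ 3 +
      1 / 8 * Pt τ * Q τ))
    fun τ ↦
      Dt τ * (495 / 16 * P τ ^ 4 - 495 / 8 * P τ ^ 3 * Pt τ + 165 / 4 * P τ ^ 2 * Pt τ ^ 2 - 11
      * P τ * Pt τ ^ 3 + 11 / 8 * P τ * Pt τ * Q τ + Pt τ ^ 4 - 5 / 8 * Pt τ ^ 2 * Q τ - 1 / 16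
      * Q τ ^ 2) := by
    refine HasDq.of_eq (by
      repeat' first
        | exact hasDq_P
        | exact hasDq_Pt
        | exact hasDq_Q
        | exact hasDq_D
        | exact hasDq_Dt
        | exact HasDq.const _
        | with_reducible apply HasDq.add
        | with_reducible apply HasDq.sub
        | with_reducible apply HasDq.mul
        | with_reducible apply HasDq.pow) fun τ ↦ ?_
    push_cast
    ring
  rw [hasDq_Dt.eq, h2.eq, h3.eq, h4.eq]
  exact ⟨rfl, rfl, rfl, rfl⟩

/-! ### The differential equations for covariants and invariants -/

/-- Clearing denominators in a linear relation between `P_k` and `Q_k` is harmless. -/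
lemma SatisfiesLinearPQ.of_cleared {k a b c : ℂ} {f : ℍ → ℂ}
    (h : ∀ τ : ℍ, a * (f τ ^ 2 * covC k f τ * covB k f τ) + b * covA k f τ ^ 2
      + c * covB k f τ ^ 3 = 0) : SatisfiesLinearPQ k a b c f := by
  refine ⟨fun τ hB ↦ ?_, h⟩
  rw [invQ, invP]
  field_simp
  linear_combination h τ

lemma satisfiesLinearPQ_Pt : SatisfiesLinearPQ 2 4 (-3) (-64) Pt := by
  refine .of_cleared fun τ ↦ ?_
  obtain ⟨h1, h2, h3, h4⟩ := dq_iterates_Pt τ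
  simp only [covA, covB, covC, h4, h3, h2, h1]
  ring

lemma satisfiesLinearPQ_Q : SatisfiesLinearPQ 4 16 (-5) (-176) Q := by
  refine .of_cleared fun τ ↦ ?_
  obtain ⟨h1, h2, h3, h4⟩ := dq_iterates_Q τ
  simp only [covA, covB, covC, h4, h3, h2, h1]
  ring

lemma satisfiesLinearPQ_D : SatisfiesLinearPQ 4 16 (-5) (-176) D := by
  refine .of_cleared fun τ ↦ ?_
  obtain ⟨h1, h2, h3, h4⟩ := dq_iterates_D τ
  simp only [covA, covB, covC, h4, h3, h2, h1]
  ring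

/-- Every term is homogeneous of degree 6 in `Dt` and its derivatives, so `Dt⁶` factors out and the
definition of `Dt` is not needed. -/
lemma satisfiesLinearPQ_Dt : SatisfiesLinearPQ 8 128 (-9) (-912) Dt := by
  refine .of_cleared fun τ ↦ ?_
  obtain ⟨h1, h2, h3, h4⟩ := dq_iterates_Dt τ
  simp only [covA, covB, covC, h4, h3, h2, h1]
  ring

lemma cov_Pt (τ : ℍ) :
    3 * covA 2 Pt τ ^ 2 + 64 * covB 2 Pt τ ^ 3 - 12 * Pt τ ^ 4 * covB 2 Pt τ ^ 2 = 0 := by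
  obtain ⟨h1, h2, h3, -⟩ := dq_iterates_Pt τ
  simp only [covA, covB, h3, h2, h1]
  ring

lemma cov_Q (τ : ℍ) :
    covA 4 Q τ ^ 2 + 16 * covB 4 Q τ ^ 3 - 16 * Q τ ^ 3 * covB 4 Q τ ^ 2 = 0 := by
  obtain ⟨h1, h2, h3, -⟩ := dq_iterates_Q τ
  simp only [covA, covB, h3, h2, h1]
  ring

lemma cov_D (τ : ℍ) :
    covA 4 D τ ^ 2 + 16 * covB 4 D τ ^ 3 - 1024 * D τ ^ 3 * covB 4 D τ ^ 2 = 0 := by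
  obtain ⟨h1, h2, h3, -⟩ := dq_iterates_D τ
  simp only [covA, covB, h3, h2, h1]
  ring

lemma cov_Dt (τ : ℍ) :
    covA 8 Dt τ ^ 2 + 16 * covB 8 Dt τ ^ 3 - 4096 * Dt τ ^ 5 * covB 8 Dt τ = 0 := by
  obtain ⟨h1, h2, h3, -⟩ := dq_iterates_Dt τ
  -- The last term has degree 7 in `Dt`, the others degree 6, so the relation `64 Dt = (Pt² - Q) Q`
  -- has to enter.
  simp only [covA, covB, h3, h2, h1, Dt, D]
  ring

/-- An equation between the covariants of weight `2`, in terms of `I₂` and `J₂`. -/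
lemma inv_two {a b c : ℂ} {f : ℍ → ℂ} {τ : ℍ} {l : ℂ} (hl : Complex.exp l = f τ)
    (h : a * covA 2 f τ ^ 2 + b * covB 2 f τ ^ 3 - c * f τ ^ 4 * covB 2 f τ ^ 2 = 0) :
    a * invJ 2 f l τ ^ 2 + b * invI 2 f l τ ^ 3 - c * invI 2 f l τ ^ 2 = 0 := by
  have hf : f τ ≠ 0 := hl ▸ Complex.exp_ne_zero l
  rw [invI, invJ, show (2 + 4 / 2 : ℂ) * l = (4 : ℕ) * l by push_cast; ring,
    show (3 + 6 / 2 : ℂ) * l = (6 : ℕ) * l by push_cast; ring, Complex.exp_nat_mul,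
    Complex.exp_nat_mul, hl]
  field_simp
  linear_combination h

/-- An equation between the covariants of weight `4`, in terms of `I₄` and `J₄`. -/
lemma inv_four {b c : ℂ} {f : ℍ → ℂ} {τ : ℍ} {l : ℂ} (hl : Complex.exp l = f τ)
    (h : covA 4 f τ ^ 2 + b * covB 4 f τ ^ 3 - c * f τ ^ 3 * covB 4 f τ ^ 2 = 0) :
    invJ 4 f l τ ^ 2 + b * invI 4 f l τ ^ 3 - c * invI 4 f l τ ^ 2 = 0 := by
  have hf : f τ ≠ 0 := hl ▸ Complex.exp_ne_zero l
  -- The exponent `9/2` is a half-integer, so only the square is independent of the logarithm.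
  have h9 : Complex.exp ((3 + 6 / 4 : ℂ) * l) ^ 2 = f τ ^ 9 := by
    rw [← hl, ← Complex.exp_nat_mul, ← Complex.exp_nat_mul]
    congr 1
    push_cast
    ring
  rw [invI, invJ, show (2 + 4 / 4 : ℂ) * l = (3 : ℕ) * l by push_cast; ring, Complex.exp_nat_mul,
    hl, div_pow, h9]
  field_simp
  linear_combination h

/-- An equation between the covariants of weight `8`, in terms of `I₈` and `J₈`. -/
lemma inv_eight {b c : ℂ} {f : ℍ → ℂ} {τ : ℍ} {l : ℂ} (hl : Complex.exp l = f τ)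
    (h : covA 8 f τ ^ 2 + b * covB 8 f τ ^ 3 - c * f τ ^ 5 * covB 8 f τ = 0) :
    invJ 8 f l τ ^ 2 + b * invI 8 f l τ ^ 3 - c * invI 8 f l τ = 0 := by
  have h5 : Complex.exp ((2 + 4 / 8 : ℂ) * l) ^ 2 = f τ ^ 5 := by
    rw [← hl, ← Complex.exp_nat_mul, ← Complex.exp_nat_mul]
    congr 1
    push_cast
    ring
  -- The denominators of `J₈²` and `I₈³` are the same power `f^(15/2)`, so with `e = f^(5/2)` only
  -- `e² = f⁵` is needed.
  have h15 : Complex.exp ((3 + 6 / 8 : ℂ) * l) ^ 2 = Complex.exp ((2 + 4 / 8 : ℂ) * l) ^ 3 := by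
    rw [← Complex.exp_nat_mul, ← Complex.exp_nat_mul]
    congr 1
    push_cast
    ring
  have h0 := Complex.exp_ne_zero ((2 + 4 / 8 : ℂ) * l)
  rw [invI, invJ, div_pow, h15]
  rw [← h5] at h
  generalize Complex.exp ((2 + 4 / 8 : ℂ) * l) = e at h h0 ⊢
  field_simp
  linear_combination h

end GammaZeroTwo
end

theorem mainTheorem7 :
    -- the system satisfied by `P`, `P̃`, `Q`
    (MDifferentiable 𝓘(ℂ) 𝓘(ℂ) GammaZeroTwo.P ∧
      ∀ τ : ℍ,
        GammaZeroTwo.dq GammaZeroTwo.P τ = (GammaZeroTwo.P τ ^ 2 - GammaZeroTwo.Q τ) / 4 ∧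
        GammaZeroTwo.dq GammaZeroTwo.Pt τ
          = (GammaZeroTwo.P τ * GammaZeroTwo.Pt τ - GammaZeroTwo.Q τ) / 2 ∧
        GammaZeroTwo.dq GammaZeroTwo.Q τ
          = (GammaZeroTwo.P τ - GammaZeroTwo.Pt τ) * GammaZeroTwo.Q τ) ∧
    -- modularity on `Γ₀(2)`
    (∃ F : ModularForm ((CongruenceSubgroup.Gamma0 2).map (Matrix.SpecialLinearGroup.mapGL ℝ)) 2,
      (F : ℍ → ℂ) = GammaZeroTwo.Pt) ∧
    (∃ F : ModularForm ((CongruenceSubgroup.Gamma0 2).map (Matrix.SpecialLinearGroup.mapGL ℝ)) 4,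
      (F : ℍ → ℂ) = GammaZeroTwo.Q) ∧
    (∃ F : ModularForm ((CongruenceSubgroup.Gamma0 2).map (Matrix.SpecialLinearGroup.mapGL ℝ)) 4,
      (F : ℍ → ℂ) = GammaZeroTwo.D) ∧
    (∃ F : CuspForm ((CongruenceSubgroup.Gamma0 2).map (Matrix.SpecialLinearGroup.mapGL ℝ)) 8,
      (F : ℍ → ℂ) = GammaZeroTwo.Dt) ∧
    -- third-order equation for `P̃`, explicitly and in invariant form
    (∀ τ : ℍ,
      let y := GammaZeroTwo.Pt τ
      let y₁ := GammaZeroTwo.dq GammaZeroTwo.Pt τ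
      let y₂ := GammaZeroTwo.dq (GammaZeroTwo.dq GammaZeroTwo.Pt) τ
      let y₃ := GammaZeroTwo.dq (GammaZeroTwo.dq (GammaZeroTwo.dq GammaZeroTwo.Pt)) τ
      3 * y ^ 2 * y₃ ^ 2 - 36 * (y * y₁ * y₂ - y₁ ^ 3) * y₃ + 32 * y * y₂ ^ 3
        - 3 * (12 * y₁ ^ 2 + y ^ 4) * y₂ ^ 2 + 9 * y ^ 3 * y₁ ^ 2 * y₂
        - 27 / 4 * y ^ 2 * y₁ ^ 4 = 0) ∧
    (∀ (τ : ℍ) (l : ℂ), Complex.exp l = GammaZeroTwo.Pt τ →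
      3 * GammaZeroTwo.invJ 2 GammaZeroTwo.Pt l τ ^ 2
        + 64 * GammaZeroTwo.invI 2 GammaZeroTwo.Pt l τ ^ 3
        - 12 * GammaZeroTwo.invI 2 GammaZeroTwo.Pt l τ ^ 2 = 0) ∧
    -- third-order equation for `Q`
    (∀ τ : ℍ,
      let y := GammaZeroTwo.Q τ
      let y₁ := GammaZeroTwo.dq GammaZeroTwo.Q τ
      let y₂ := GammaZeroTwo.dq (GammaZeroTwo.dq GammaZeroTwo.Q) τ
      let y₃ := GammaZeroTwo.dq (GammaZeroTwo.dq (GammaZeroTwo.dq GammaZeroTwo.Q)) τ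
      4 * y ^ 4 * y₃ ^ 2 - 6 * y ^ 2 * y₁ * (6 * y * y₂ - 5 * y₁ ^ 2) * y₃ + 16 * y ^ 3 * y₂ ^ 3
        + y ^ 2 * (21 * y₁ ^ 2 - 4 * y ^ 3) * y₂ ^ 2
        - 10 * y * y₁ ^ 2 * (6 * y₁ ^ 2 - y ^ 3) * y₂ + 25 * y₁ ^ 6
        - 25 / 4 * y ^ 3 * y₁ ^ 4 = 0) ∧
    (∀ (τ : ℍ) (l : ℂ), Complex.exp l = GammaZeroTwo.Q τ →
      GammaZeroTwo.invJ 4 GammaZeroTwo.Q l τ ^ 2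
        + 16 * GammaZeroTwo.invI 4 GammaZeroTwo.Q l τ ^ 3
        - 16 * GammaZeroTwo.invI 4 GammaZeroTwo.Q l τ ^ 2 = 0) ∧
    -- third-order equation for `D`
    (∀ τ : ℍ,
      let y := GammaZeroTwo.D τ
      let y₁ := GammaZeroTwo.dq GammaZeroTwo.D τ
      let y₂ := GammaZeroTwo.dq (GammaZeroTwo.dq GammaZeroTwo.D) τ
      let y₃ := GammaZeroTwo.dq (GammaZeroTwo.dq (GammaZeroTwo.dq GammaZeroTwo.D)) τ
      4 * y ^ 4 * y₃ ^ 2 - 6 * y ^ 2 * y₁ * (6 * y * y₂ - 5 * y₁ ^ 2) * y₃ + 16 * y ^ 3 * y₂ ^ 3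
        - y ^ 2 * (256 * y ^ 3 - 21 * y₁ ^ 2) * y₂ ^ 2
        + 20 * y * y₁ ^ 2 * (32 * y ^ 3 - 3 * y₁ ^ 2) * y₂ + 25 * y₁ ^ 6
        - 400 * y ^ 3 * y₁ ^ 4 = 0) ∧
    (∀ (τ : ℍ) (l : ℂ), Complex.exp l = GammaZeroTwo.D τ →
      GammaZeroTwo.invJ 4 GammaZeroTwo.D l τ ^ 2
        + 16 * GammaZeroTwo.invI 4 GammaZeroTwo.D l τ ^ 3
        - 1024 * GammaZeroTwo.invI 4 GammaZeroTwo.D l τ ^ 2 = 0) ∧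
    -- third-order equation for `D̃`
    (∀ τ : ℍ,
      let y := GammaZeroTwo.Dt τ
      let y₁ := GammaZeroTwo.dq GammaZeroTwo.Dt τ
      let y₂ := GammaZeroTwo.dq (GammaZeroTwo.dq GammaZeroTwo.Dt) τ
      let y₃ := GammaZeroTwo.dq (GammaZeroTwo.dq (GammaZeroTwo.dq GammaZeroTwo.Dt)) τ
      16 * y ^ 4 * y₃ ^ 2 - 30 * y ^ 2 * y₁ * (4 * y * y₂ - 3 * y₁ ^ 2) * y₃
        + 32 * y ^ 3 * y₂ ^ 3 + 117 * y ^ 2 * y₁ ^ 2 * y₂ ^ 2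
        - 8 * y * (16 * y ^ 5 + 27 * y₁ ^ 4) * y₂ + 81 * y₁ ^ 6
        + 144 * y ^ 5 * y₁ ^ 2 = 0) ∧
    (∀ (τ : ℍ) (l : ℂ), Complex.exp l = GammaZeroTwo.Dt τ →
      GammaZeroTwo.invJ 8 GammaZeroTwo.Dt l τ ^ 2
        + 16 * GammaZeroTwo.invI 8 GammaZeroTwo.Dt l τ ^ 3
        - 4096 * GammaZeroTwo.invI 8 GammaZeroTwo.Dt l τ = 0) ∧
    -- fourth-order equations in terms of `P_k` and `Q_k`
    GammaZeroTwo.SatisfiesLinearPQ 8 128 (-9) (-912) GammaZeroTwo.Dt ∧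
    GammaZeroTwo.SatisfiesLinearPQ 2 4 (-3) (-64) GammaZeroTwo.Pt ∧
    GammaZeroTwo.SatisfiesLinearPQ 4 16 (-5) (-176) GammaZeroTwo.Q ∧
    GammaZeroTwo.SatisfiesLinearPQ 4 16 (-5) (-176) GammaZeroTwo.D := by
  open GammaZeroTwo in
  refine ⟨⟨hasDq_P.1, fun τ ↦ ⟨?_, ?_, ?_⟩⟩, hasCuspValues_Pt.exists_modularForm,
    hasCuspValues_Q.exists_modularForm, hasCuspValues_D.exists_modularForm,
    exists_cuspForm hasCuspValues_Dt.mdiff hasCuspValues_Dt.slash_eq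
      hasCuspValues_Dt.tendsto_infty hasCuspValues_Dt.tendsto_zero, fun τ ↦ ?_,
    fun τ l hl ↦ inv_two hl (cov_Pt τ), fun τ ↦ ?_,
    fun τ l hl ↦ inv_four hl (cov_Q τ), fun τ ↦ ?_,
    fun τ l hl ↦ inv_four hl (cov_D τ), fun τ ↦ ?_,
    fun τ l hl ↦ inv_eight hl (cov_Dt τ), satisfiesLinearPQ_Dt, satisfiesLinearPQ_Pt,
    satisfiesLinearPQ_Q, satisfiesLinearPQ_D⟩
  · rw [hasDq_P.2]
    ring
  · rw [hasDq_Pt.2]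
    ring
  · rw [hasDq_Q.2]
    ring
  · obtain ⟨h1, h2, h3, -⟩ := dq_iterates_Pt τ
    simp only [h3, h2, h1]
    ring
  · obtain ⟨h1, h2, h3, -⟩ := dq_iterates_Q τ
    simp only [h3, h2, h1]
    ring
  · obtain ⟨h1, h2, h3, -⟩ := dq_iterates_D τ
    simp only [h3, h2, h1]
    ring
  · obtain ⟨h1, h2, h3, -⟩ := dq_iterates_Dt τ
    simp only [h3, h2, h1, Dt, D]
    ring
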